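/- Let $\mathbb{H}=\{z=x+iy : y>0\}$ be the hyperbolic upper half plane with Laplace--Beltrami operator $\triangle=y^2(\partial_x^2+\partial_y^2)$, and let $\rho:\mathbb{H}\to\mathbb{H}$ be the reflection $\rho(z)=-\bar z$. Let $\Gamma\subset SL(2,\mathbb{R})$ be a discrete subgroup such that $Y=\Gamma\backslash\mathbb{H}$ is compact, and suppose that the imaginary axis $\{iy : y>0\}$ projects to a closed geodesic $\gamma$ on $Y$, i.e. some element of $\Gamma$ acts on the axis by $iy\mapsto ie^{L}y$ for some $L>0$. An eigenfunction on $Y$ is a real-valued, $\Gamma$-invariant $C^2$ function $\phi$ on $\mathbb{H}$ with $\triangle\phi=\mu\phi$ for some $\mu\in\mathbb{R}$. Then the following are equivalent: (a) there exists a non-constant eigenfunction $\phi$ on $Y$ which vanishes identically on $\gamma$, i.e. $\phi(iy)=0$ for all $y>0$; (b) $\Gamma$ has finite index in the group generated by $\Gamma$ and $\rho^{-1}\Gamma\rho$ (all regarded as groups of transformations of $\mathbb{H}$). -/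

import Mathlib

open scoped UpperHalfPlane MatrixGroups

namespace HypSurf

noncomputable section

/-- The reflection `ρ(z) = -z̄` of the upper half plane in the imaginary axis. -/
def rho : Equiv.Perm ℍ where
  toFun z := ⟨-(starRingEnd ℂ) (z : ℂ), by simpa using z.im_pos⟩
  invFun z := ⟨-(starRingEnd ℂ) (z : ℂ), by simpa using z.im_pos⟩
  left_inv z := by ext; simp
  right_inv z := by ext; simp

/-- The unit speed parametrisation `t ↦ i eᵗ` of the imaginary axis as a hyperbolic geodesic. -/
def axis (t : ℝ) : ℍ := ⟨⟨0, Real.exp t⟩, Real.exp_pos t⟩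

/-- The imaginary axis projects to a closed geodesic of `Γ \ ℍ`: some element of `Γ` translates it
along itself by a positive length. -/
def AxisIsClosed (Γ : Subgroup SL(2, ℝ)) : Prop :=
  ∃ g ∈ Γ, ∃ L : ℝ, 0 < L ∧ ∀ t : ℝ, g • axis t = axis (t + L)

/-- The Laplace-Beltrami operator `y² (∂²/∂x² + ∂²/∂y²)` of the hyperbolic plane. The function
`φ ∘ UpperHalfPlane.ofComplex` agrees with `φ` on the open set `{z : ℂ | 0 < z.im}`. -/
def hypLaplacian (φ : ℍ → ℝ) (z : ℍ) : ℝ :=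
  z.im ^ 2 * Laplacian.laplacian (φ ∘ UpperHalfPlane.ofComplex) (z : ℂ)

/-- `φ` is a (real-valued, classical) solution of `△ φ = μ φ` on `Γ \ ℍ`, i.e. a `Γ`-invariant
`C²` function on `ℍ` satisfying this equation. -/
structure IsLaplaceEigenfunction (Γ : Subgroup SL(2, ℝ)) (μ : ℝ) (φ : ℍ → ℝ) : Prop where
  invariant : ∀ g ∈ Γ, ∀ z : ℍ, φ (g • z) = φ z
  contDiffOn : ContDiffOn ℝ 2 (φ ∘ UpperHalfPlane.ofComplex) {z : ℂ | 0 < z.im}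
  eigen : ∀ z : ℍ, hypLaplacian φ z = μ * φ z

/-- `Γ` as a group of transformations of `ℍ`. -/
def transf (Γ : Subgroup SL(2, ℝ)) : Subgroup (Equiv.Perm ℍ) :=
  Γ.map (MulAction.toPermHom SL(2, ℝ) ℍ)

/-- The group `ρ⁻¹ Γ ρ` of transformations of `ℍ`. -/
def rhoConj (Γ : Subgroup SL(2, ℝ)) : Subgroup (Equiv.Perm ℍ) :=
  (transf Γ).map (MulAut.conj rho⁻¹).toMonoidHom

/-- The group of transformations of `ℍ` generated by `Γ` and `ρ⁻¹ Γ ρ`. -/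
def symmGroup (Γ : Subgroup SL(2, ℝ)) : Subgroup (Equiv.Perm ℍ) :=
  transf Γ ⊔ rhoConj Γ

end

end HypSurf

/-!
The proof has two independent halves.

*An eigenfunction vanishing on the axis forces finite index.* In the conformal coordinate
`log z = s + iθ` an eigenfunction `φ` becomes a function `u(s, θ)`, periodic in `s` because the axis
is closed, with `u_ss + u_θθ = μ / sin² θ · u`. Each Fourier coefficient of `u` in `s` solves a
linear second order equation in `θ` whose potential is symmetric about `θ = π / 2`. If `φ` vanishes
on the axis, the even part of the coefficient has zero Cauchy data at `θ = π / 2`, hence is zero;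
so `φ (ρ z) = -φ z` (`IsLaplaceEigenfunction.comp_rho_eq_neg`). Consequently the closed group `S`
of all matrices leaving `φ` invariant contains `Γ` and its conjugate by `ρ`. The group `S` is
discrete (`discreteTopology_invarianceGroup`): otherwise, renormalizing elements near `1` by powers
of the translation along the axis, it would contain a full horocyclic subgroup
(`upperUnipotent_mem_of_frequently`), and `φ`, being zero on the axis, would be zero everywhere. A
discrete group containing the cocompact group `Γ` contains it with finite index, and the group
generated by `Γ` and `ρ⁻¹ Γ ρ` lies between the two.

*Finite index gives an eigenfunction vanishing on the axis.* The group `G` generated by `Γ`, its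
conjugate and `ρ` is then again properly discontinuous and cocompact, and it has a character `ε`
which is `1` on the orientation preserving elements and `-1` on the others. It suffices to find a
non-zero eigenfunction that transforms by `ε`, since such a function is odd under `ρ`. For a smooth
`κ` supported near `1`, the kernel `A_κ(z, w) = ∑ ε(g) κ(cosh d(z, g w))` defines a compact symmetric
operator on the `L²` space of a compact set carrying a weight which replaces a fundamental domain.
The Laplacian turns `A_κ` into `A_κ'`, where `κ'` is the radial Laplacian of `κ`. These two
operators commute, because any two points of the plane are exchanged by an isometry
(`integral_weight_mul_autoKernel_comm`). A common eigenfunction for a non-zero eigenvalue of the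
first, which exists by the spectral theorem for compact operators (`exists_common_eigenfunction`),
is therefore smooth and an eigenfunction of the Laplacian
(`IsCocompactIsometryGroup.exists_eigenfunction`). The first operator is not zero because its kernel
does not vanish at `(z₀, z₀)`, for a point `z₀` fixed by no orientation reversing element of `G` and
`κ` supported close enough to `1`.
-/

namespace HypSurf

noncomputable section

open MeasureTheory Set Filter Topology

/-! ### Commuting integral operators with continuous symmetric kernels -/

section KernelOperator

open scoped BoundedContinuousFunction

variable {X : Type*} [MetricSpace X] [CompactSpace X] [MeasurableSpace X] [BorelSpace X]
  (ν : Measure X) [IsFiniteMeasure ν]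

/-- The row `K(x, ·)` of a continuous kernel, as a continuous map from `X` to `L²(ν)`. -/
def kernelRow (K : C(X × X, ℝ)) : C(X, Lp ℝ 2 ν) :=
  ⟨fun x => ContinuousMap.toLp 2 ν ℝ (K.curry x),
    (ContinuousMap.toLp 2 ν ℝ).continuous.comp K.curry.continuous⟩

lemma coeFn_kernelRow (K : C(X × X, ℝ)) (x : X) :
    (kernelRow ν K x : X → ℝ) =ᵐ[ν] fun y => K (x, y) :=
  ContinuousMap.coeFn_toLp ν (K.curry x)

/-- The integral operator `f ↦ ∫ K(·, y) f(y) dν(y)`, from `L²(ν)` to the continuous functions. -/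
def kernelOp (K : C(X × X, ℝ)) : Lp ℝ 2 ν →L[ℝ] (X →ᵇ ℝ) :=
  LinearMap.mkContinuous
    { toFun := fun f => BoundedContinuousFunction.mkOfCompact
        ⟨fun x => inner ℝ (kernelRow ν K x) f, by fun_prop⟩
      map_add' := fun f g => by ext x; simp [inner_add_right]
      map_smul' := fun c f => by ext x; simp [inner_smul_right] }
    ‖kernelRow ν K‖ (fun f => by
      refine (BoundedContinuousFunction.norm_le (by positivity)).2 fun x => ?_
      exact (norm_inner_le_norm _ _).trans
        (mul_le_mul_of_nonneg_right ((kernelRow ν K).norm_coe_le_norm x) (norm_nonneg _)))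

lemma kernelOp_eq_inner (K : C(X × X, ℝ)) (f : Lp ℝ 2 ν) (x : X) :
    kernelOp ν K f x = inner ℝ (kernelRow ν K x) f := rfl

lemma kernelOp_apply (K : C(X × X, ℝ)) (f : Lp ℝ 2 ν) (x : X) :
    kernelOp ν K f x = ∫ y, K (x, y) * f y ∂ν := by
  rw [kernelOp_eq_inner, L2.inner_def]
  refine integral_congr_ae ((coeFn_kernelRow ν K x).mono fun y hy => ?_)
  simp only [hy, RCLike.inner_apply, conj_trivial]
  ring

lemma integrable_coeFn_Lp_two {Y : Type*} [MeasurableSpace Y] (ν : Measure Y) [IsFiniteMeasure ν]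
    (f : Lp ℝ 2 ν) : Integrable (f : Y → ℝ) ν :=
  (Lp.memLp f).integrable one_le_two

/-- By Arzelà–Ascoli: the image of the unit ball is bounded, and equicontinuous because the rows
of the kernel depend continuously on the row index. -/
lemma isCompactOperator_kernelOp (K : C(X × X, ℝ)) : IsCompactOperator (kernelOp ν K) := by
  refine (isCompactOperator_iff_isCompact_closure_image_closedBall
    (kernelOp ν K).toLinearMap one_pos).2 ?_
  refine BoundedContinuousFunction.arzela_ascoli (Metric.closedBall (0 : ℝ) ‖kernelRow ν K‖)
    (isCompact_closedBall _ _) _ ?_ ?_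
  · rintro _ x ⟨f, hf, rfl⟩
    rw [mem_closedBall_zero_iff] at hf ⊢
    refine (norm_inner_le_norm (𝕜 := ℝ) (kernelRow ν K x) f).trans ?_
    exact (mul_le_of_le_one_right (norm_nonneg _) hf).trans
      ((kernelRow ν K).norm_coe_le_norm x)
  · intro x₀
    rw [Metric.equicontinuousAt_iff]
    intro ε hε
    obtain ⟨δ, hδ, h⟩ := Metric.continuousAt_iff.1
      ((kernelRow ν K).continuous.continuousAt (x := x₀)) ε hε
    refine ⟨δ, hδ, ?_⟩
    rintro x hx ⟨_, f, hf, rfl⟩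
    rw [mem_closedBall_zero_iff] at hf
    have := h hx
    rw [dist_eq_norm] at this
    change dist (inner ℝ (kernelRow ν K x₀) f) (inner ℝ (kernelRow ν K x) f) < ε
    rw [dist_comm, dist_eq_norm, ← inner_sub_left]
    exact ((norm_inner_le_norm _ _).trans (mul_le_of_le_one_right (norm_nonneg _) hf)).trans_lt this

/-- The integral operator with kernel `K` on `L²(ν)`. -/
def kernelEnd (K : C(X × X, ℝ)) : Lp ℝ 2 ν →L[ℝ] Lp ℝ 2 ν :=
  (BoundedContinuousFunction.toLp 2 ν ℝ).comp (kernelOp ν K)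

lemma coeFn_kernelEnd (K : C(X × X, ℝ)) (f : Lp ℝ 2 ν) :
    (kernelEnd ν K f : X → ℝ) =ᵐ[ν] fun x => ∫ y, K (x, y) * f y ∂ν :=
  (BoundedContinuousFunction.coeFn_toLp 2 ν ℝ (kernelOp ν K f)).trans
    (ae_of_all _ fun x => kernelOp_apply ν K f x)

lemma isCompactOperator_kernelEnd (K : C(X × X, ℝ)) : IsCompactOperator (kernelEnd ν K) :=
  (isCompactOperator_kernelOp ν K).clm_comp (BoundedContinuousFunction.toLp 2 ν ℝ)

lemma isSymmetric_kernelEnd (K : C(X × X, ℝ)) (hK : ∀ x y, K (x, y) = K (y, x)) :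
    (kernelEnd ν K).IsSymmetric := by
  intro f g
  change inner ℝ (kernelEnd ν K f) g = inner ℝ f (kernelEnd ν K g)
  have h1 : inner ℝ (kernelEnd ν K f) g = ∫ x, ∫ y, K (x, y) * (f y * g x) ∂ν ∂ν := by
    rw [L2.inner_def]
    refine integral_congr_ae ((coeFn_kernelEnd ν K f).mono fun x hx => ?_)
    simp only [hx, RCLike.inner_apply, conj_trivial]
    rw [← integral_const_mul]
    congr 1; ext y; ring
  have h2 : inner ℝ f (kernelEnd ν K g) = ∫ y, ∫ x, K (x, y) * (f y * g x) ∂ν ∂ν := by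
    rw [L2.inner_def]
    refine integral_congr_ae ((coeFn_kernelEnd ν K g).mono fun x hx => ?_)
    simp only [hx, RCLike.inner_apply, conj_trivial]
    rw [← integral_mul_const]
    congr 1; ext y; rw [hK]; ring
  rw [h1, h2]
  refine integral_integral_swap ?_
  refine Integrable.bdd_mul (c := ‖K‖) ?_ K.continuous.aestronglyMeasurable
    (ae_of_all _ fun y => K.norm_coe_le_norm _)
  refine ((integrable_coeFn_Lp_two ν g).mul_prod (integrable_coeFn_Lp_two ν f)).congr ?_
  exact ae_of_all _ fun p => mul_comm _ _

lemma kernelOp_kernelEnd_apply (K K' : C(X × X, ℝ)) (f : Lp ℝ 2 ν) (x : X) :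
    kernelOp ν K (kernelEnd ν K' f) x = ∫ z, (∫ y, K (x, y) * K' (y, z) ∂ν) * f z ∂ν := by
  have h1 : kernelOp ν K (kernelEnd ν K' f) x = ∫ y, ∫ z, K (x, y) * K' (y, z) * f z ∂ν ∂ν := by
    rw [kernelOp_apply]
    refine integral_congr_ae ((coeFn_kernelEnd ν K' f).mono fun y hy => ?_)
    simp only [hy, ← integral_const_mul, mul_assoc]
  rw [h1, integral_integral_swap]
  · simp only [integral_mul_const]
  · have hc : Continuous fun p : X × X => K (x, p.1) * K' p := by fun_prop
    have hf : Integrable (fun p : X × X => f p.2) (ν.prod ν) :=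
      (integrable_coeFn_Lp_two ν f).comp_snd ν
    exact hf.bdd_mul (c := ‖(⟨_, hc⟩ : C(X × X, ℝ))‖) hc.aestronglyMeasurable
      (ae_of_all _ fun y => (⟨_, hc⟩ : C(X × X, ℝ)).norm_coe_le_norm y)

/-- Two commuting symmetric integral operators have a common eigenfunction, with a non-zero
eigenvalue of the first one, provided the first kernel does not vanish at some point of the
diagonal over the support of the measure. -/
lemma exists_common_eigenfunction (K K' : C(X × X, ℝ)) (hK : ∀ x y, K (x, y) = K (y, x))
    (hK' : ∀ x y, K' (x, y) = K' (y, x))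
    (hcomm : ∀ x z, ∫ y, K (x, y) * K' (y, z) ∂ν = ∫ y, K' (x, y) * K (y, z) ∂ν)
    (x₀ : X) (hx₀ : K (x₀, x₀) ≠ 0) (hν : ∀ U ∈ 𝓝 x₀, ν U ≠ 0) :
    ∃ (f : X → ℝ) (a b : ℝ), Continuous f ∧ a ≠ 0 ∧ (∃ x, f x ≠ 0) ∧
      (∀ x, ∫ y, K (x, y) * f y ∂ν = a * f x) ∧ ∀ x, ∫ y, K' (x, y) * f y ∂ν = b * f x := by
  -- the operator `T` is not zero: it does not kill the row through `x₀`
  have hT0 : kernelEnd ν K ≠ 0 := by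
    intro h0
    have h1 : (fun x => kernelOp ν K (kernelRow ν K x₀) x) =ᵐ[ν] 0 := by
      refine (BoundedContinuousFunction.coeFn_toLp 2 ν ℝ
        (kernelOp ν K (kernelRow ν K x₀))).symm.trans ?_
      have : kernelEnd ν K (kernelRow ν K x₀) = 0 := by rw [h0]; rfl
      change (kernelEnd ν K (kernelRow ν K x₀) : X → ℝ) =ᵐ[ν] 0
      rw [this]
      exact Lp.coeFn_zero _ _ _
    have h2 : kernelRow ν K x₀ ≠ 0 := by
      intro h
      have h3 : (fun y => K (x₀, y)) =ᵐ[ν] 0 := by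
        refine (coeFn_kernelRow ν K x₀).symm.trans ?_
        rw [h]
        exact Lp.coeFn_zero _ _ _
      have h4 : ∀ᶠ y in 𝓝 x₀, K (x₀, y) ≠ 0 :=
        (K.continuous.comp (Continuous.prodMk_right x₀)).continuousAt.eventually_ne hx₀
      exact hν _ h4 (by simpa [Filter.EventuallyEq, ae_iff] using h3)
    have h5 : kernelOp ν K (kernelRow ν K x₀) x₀ ≠ 0 := by
      rw [kernelOp_eq_inner]
      exact inner_self_ne_zero.2 h2
    have h6 : ∀ᶠ x in 𝓝 x₀, kernelOp ν K (kernelRow ν K x₀) x ≠ 0 :=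
      (kernelOp ν K (kernelRow ν K x₀)).continuous.continuousAt.eventually_ne h5
    exact hν _ h6 (by simpa [Filter.EventuallyEq, ae_iff] using h1)
  have hTc := isCompactOperator_kernelEnd ν K
  have hTs := isSymmetric_kernelEnd ν K hK
  obtain ⟨a, ha, ha0⟩ : ∃ a, Module.End.HasEigenvalue (kernelEnd ν K : Module.End ℝ (Lp ℝ 2 ν)) a
      ∧ a ≠ 0 := by
    have := (ContinuousLinearMap.eq_zero_of_forall_hasEigenvalue_eq_zero hTc hTs).not.2 hT0
    push Not at this
    exact this
  have hfin := ContinuousLinearMap.finite_dimensional_eigenspace hTc a ha0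
  set W := Module.End.eigenspace (kernelEnd ν K).toLinearMap a with hW
  have hcommOp : ∀ f : Lp ℝ 2 ν,
      kernelOp ν K (kernelEnd ν K' f) = kernelOp ν K' (kernelEnd ν K f) := by
    intro f
    ext x
    rw [kernelOp_kernelEnd_apply, kernelOp_kernelEnd_apply]
    simp only [hcomm]
  have hmaps : ∀ v ∈ W, (kernelEnd ν K').toLinearMap v ∈ W := by
    intro v hv
    rw [hW, Module.End.mem_eigenspace_iff] at hv ⊢
    change (BoundedContinuousFunction.toLp 2 ν ℝ) (kernelOp ν K (kernelEnd ν K' v)) = _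
    rw [hcommOp v]
    change kernelEnd ν K' (kernelEnd ν K v) = a • kernelEnd ν K' v
    rw [← map_smul]
    exact congrArg _ hv
  -- the second operator has an eigenvector in the finite dimensional eigenspace of the first
  have hsymm := (isSymmetric_kernelEnd ν K' hK').restrict_invariant hmaps
  have : Nontrivial W := Submodule.nontrivial_iff_ne_bot.2 ha
  obtain ⟨⟨v, hv⟩, hv1, hv2⟩ := hsymm.hasEigenvalue_iSup_of_finiteDimensional.exists_hasEigenvector
  set b := ⨆ x : { x : W // x ≠ 0 }, RCLike.re (inner ℝ
    ((LinearMap.restrict (kernelEnd ν K').toLinearMap hmaps) x) (x : W)) / ‖(x : W)‖ ^ 2 with hb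
  have hTv : kernelEnd ν K v = a • v := Module.End.mem_eigenspace_iff.1 hv
  have hT'v : kernelEnd ν K' v = b • v := by
    have := congrArg Subtype.val (Module.End.mem_eigenspace_iff.1 hv1)
    exact this
  have hv0 : v ≠ 0 := fun h => hv2 (Subtype.ext h)
  -- replace the class `v` by the continuous function `K v`, which is a multiple of it
  set f := kernelOp ν K v with hf
  have hint : ∀ (M : C(X × X, ℝ)) (x : X),
      ∫ y, M (x, y) * f y ∂ν = kernelOp ν M (kernelEnd ν K v) x := by
    intro M x
    rw [kernelOp_apply]
    refine integral_congr_ae ?_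
    filter_upwards [BoundedContinuousFunction.coeFn_toLp 2 ν ℝ f] with y hy
    change _ = M (x, y) * ((BoundedContinuousFunction.toLp 2 ν ℝ) f : Lp ℝ 2 ν) y
    rw [hy]
  refine ⟨f, a, b, f.continuous, ha0, ?_, fun x => ?_, fun x => ?_⟩
  · by_contra! h
    have : f = 0 := by ext x; exact h x
    have h2 : kernelEnd ν K v = 0 := by
      change (BoundedContinuousFunction.toLp 2 ν ℝ) f = 0
      rw [this, map_zero]
    rw [hTv] at h2
    exact hv0 ((smul_eq_zero.1 h2).resolve_left ha0)
  · rw [hint, hTv, map_smul]; rfl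
  · rw [hint, ← hcommOp, hT'v, map_smul]; rfl

end KernelOperator

/-! ### Differentiation under the integral sign -/

section ParametricIntegral

variable {X : Type*} [MetricSpace X] [CompactSpace X] [MeasurableSpace X] [BorelSpace X]
  (ν : Measure X) [IsFiniteMeasure ν] {E F : Type} [NormedAddCommGroup E] [NormedSpace ℝ E]
  [NormedAddCommGroup F] [NormedSpace ℝ F]

/-- The partial derivative of `Ψ` in its first variable. -/
def partialFDeriv (Ψ : E × E → F) (p : E × E) : E →L[ℝ] F :=
  (fderiv ℝ Ψ p).comp (ContinuousLinearMap.inl ℝ E E)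

lemma contDiffOn_partialFDeriv {Ψ : E × E → F} {O : Set (E × E)} (hO : IsOpen O) {n m : ℕ}
    (hΨ : ContDiffOn ℝ n Ψ O) (hmn : m + 1 ≤ n) :
    ContDiffOn ℝ m (partialFDeriv Ψ) O := by
  have h := hΨ.fderiv_of_isOpen hO (m := m) (by exact_mod_cast hmn)
  exact h.clm_comp contDiffOn_const

lemma hasFDerivAt_partial {Ψ : E × E → F} {O : Set (E × E)} (hO : IsOpen O)
    (hΨ : ContDiffOn ℝ 1 Ψ O) {x w : E} (h : (x, w) ∈ O) :
    HasFDerivAt (fun x' => Ψ (x', w)) (partialFDeriv Ψ (x, w)) x := by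
  have h1 := ((hΨ.contDiffAt (hO.mem_nhds h)).differentiableAt (by simp)).hasFDerivAt
  exact h1.comp x (hasFDerivAt_prodMk_left x w)

variable [FiniteDimensional ℝ E]

lemma hasFDerivAt_integral_smul {Ψ : E × E → F} {O : Set (E × E)} (hO : IsOpen O)
    (hΨ : ContDiffOn ℝ 1 Ψ O) {V : Set E} (hV : IsOpen V) {q : X → E} (hq : Continuous q)
    (hVq : ∀ x ∈ V, ∀ y, (x, q y) ∈ O) {f : X → ℝ} (hf : Continuous f) {x : E} (hx : x ∈ V) :
    HasFDerivAt (fun x' => ∫ y, f y • Ψ (x', q y) ∂ν)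
      (∫ y, f y • partialFDeriv Ψ (x, q y) ∂ν) x := by
  have hD : ContinuousOn (partialFDeriv Ψ) O :=
    (contDiffOn_partialFDeriv (n := 1) (m := 0) hO (by exact_mod_cast hΨ) le_rfl).continuousOn
  have hcont : ∀ x' ∈ V, Continuous fun y => f y • Ψ (x', q y) := fun x' hx' =>
    hf.smul (hΨ.continuousOn.comp_continuous (by fun_prop) fun y => hVq x' hx' y)
  have hcont' : Continuous fun y => f y • partialFDeriv Ψ (x, q y) :=
    hf.smul (hD.comp_continuous (by fun_prop) fun y => hVq x hx y)
  obtain ⟨r, hr, hrV⟩ := Metric.nhds_basis_closedBall.mem_iff.1 (hV.mem_nhds hx)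
  have hcomp : IsCompact (Metric.closedBall x r ×ˢ (univ : Set X)) := by
    have : ProperSpace E := FiniteDimensional.proper ℝ E
    exact (isCompact_closedBall x r).prod isCompact_univ
  have hc2 : ContinuousOn (fun p : E × X => f p.2 • partialFDeriv Ψ (p.1, q p.2))
      (Metric.closedBall x r ×ˢ univ) := by
    refine (hf.comp continuous_snd).continuousOn.smul (hD.comp (by fun_prop) ?_)
    rintro ⟨a, b⟩ ⟨ha, -⟩
    exact hVq a (hrV ha) b
  obtain ⟨M, hM⟩ := hcomp.exists_bound_of_continuousOn hc2
  refine hasFDerivAt_integral_of_dominated_of_fderiv_le (s := Metric.closedBall x r)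
    (F' := fun x y => f y • partialFDeriv Ψ (x, q y)) (bound := fun _ => M)
    (Metric.closedBall_mem_nhds x hr) ?_ ?_ hcont'.aestronglyMeasurable ?_
    (integrable_const M) ?_
  · filter_upwards [hV.mem_nhds hx] with x' hx' using (hcont x' hx').aestronglyMeasurable
  · exact (hcont x hx).integrable_of_hasCompactSupport (HasCompactSupport.of_compactSpace _)
  · exact ae_of_all _ fun y x' hx' => hM (x', y) ⟨hx', mem_univ _⟩
  · exact ae_of_all _ fun y x' hx' =>
      (hasFDerivAt_partial hO hΨ (hVq x' (hrV hx') y)).const_smul (f y)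

/-- One derivative more is assumed of the integrand than is obtained for the integral. -/
lemma contDiffOn_integral_smul (n : ℕ) : ∀ {F : Type} [NormedAddCommGroup F] [NormedSpace ℝ F]
    {Ψ : E × E → F} {O : Set (E × E)} (_ : IsOpen O) (_ : ContDiffOn ℝ (n + 1 : ℕ) Ψ O)
    {V : Set E} (_ : IsOpen V) {q : X → E} (_ : Continuous q) (_ : ∀ x ∈ V, ∀ y, (x, q y) ∈ O)
    {f : X → ℝ} (_ : Continuous f), ContDiffOn ℝ n (fun x => ∫ y, f y • Ψ (x, q y) ∂ν) V := by
  induction n with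
  | zero =>
    intro F _ _ Ψ O hO hΨ V hV q hq hVq f hf
    have : ContinuousOn (fun x => ∫ y, f y • Ψ (x, q y) ∂ν) V := fun x hx =>
      (hasFDerivAt_integral_smul ν hO (by exact_mod_cast hΨ) hV hq hVq hf
        hx).continuousAt.continuousWithinAt
    exact_mod_cast contDiffOn_zero.2 this
  | succ n ih =>
    intro F _ _ Ψ O hO hΨ V hV q hq hVq f hf
    have h1 : ContDiffOn ℝ 1 Ψ O := hΨ.of_le (by exact_mod_cast Nat.succ_le_succ (Nat.zero_le _))
    have hd := fun x hx => hasFDerivAt_integral_smul ν hO h1 hV hq hVq hf (x := x) hx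
    have : ContDiffOn ℝ ((n : WithTop ℕ∞) + 1) (fun x => ∫ y, f y • Ψ (x, q y) ∂ν) V := by
      rw [contDiffOn_succ_iff_fderiv_of_isOpen hV]
      refine ⟨fun x hx => (hd x hx).differentiableAt.differentiableWithinAt, by simp, ?_⟩
      refine (ih hO (contDiffOn_partialFDeriv hO hΨ le_rfl) hV hq hVq hf).congr fun x hx => ?_
      exact (hd x hx).fderiv
    exact_mod_cast this

/-- The second derivative of a parametric integral is the integral of the second derivatives. -/
lemma fderiv_fderiv_integral_smul {Ψ : E × E → F} {O : Set (E × E)} (hO : IsOpen O)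
    (hΨ : ContDiffOn ℝ 2 Ψ O) {V : Set E} (hV : IsOpen V) {q : X → E} (hq : Continuous q)
    (hVq : ∀ x ∈ V, ∀ y, (x, q y) ∈ O) {f : X → ℝ} (hf : Continuous f) {x : E} (hx : x ∈ V)
    (u v : E) [CompleteSpace F] :
    Integrable (fun y => f y • fderiv ℝ (fderiv ℝ fun x' => Ψ (x', q y)) x u v) ν ∧
    fderiv ℝ (fderiv ℝ fun x' => ∫ y, f y • Ψ (x', q y) ∂ν) x u v =
      ∫ y, f y • fderiv ℝ (fderiv ℝ fun x' => Ψ (x', q y)) x u v ∂ν := by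
  have h1 : ContDiffOn ℝ 1 Ψ O := hΨ.of_le (by norm_num)
  have h1' : ContDiffOn ℝ 1 (partialFDeriv Ψ) O := by
    exact_mod_cast contDiffOn_partialFDeriv (n := 2) (m := 1) hO (by exact_mod_cast hΨ) le_rfl
  have hD : ContinuousOn (partialFDeriv (partialFDeriv Ψ)) O :=
    (contDiffOn_partialFDeriv (n := 1) (m := 0) hO (by exact_mod_cast h1') le_rfl).continuousOn
  have e1 : fderiv ℝ (fun x' => ∫ y, f y • Ψ (x', q y) ∂ν) =ᶠ[𝓝 x]
      fun x' => ∫ y, f y • partialFDeriv Ψ (x', q y) ∂ν := by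
    filter_upwards [hV.mem_nhds hx] with x' hx'
    exact (hasFDerivAt_integral_smul ν hO h1 hV hq hVq hf hx').fderiv
  have e2 : ∀ y, f y • fderiv ℝ (fderiv ℝ fun x' => Ψ (x', q y)) x u v =
      (f y • partialFDeriv (partialFDeriv Ψ) (x, q y)) u v := fun y => by
    have e3 : fderiv ℝ (fun x' => Ψ (x', q y)) =ᶠ[𝓝 x] fun x' => partialFDeriv Ψ (x', q y) := by
      filter_upwards [hV.mem_nhds hx] with x' hx'
      exact (hasFDerivAt_partial hO h1 (hVq x' hx' y)).fderiv
    rw [e3.fderiv_eq, (hasFDerivAt_partial hO h1' (hVq x hx y)).fderiv]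
    rfl
  have hcont : Continuous fun y => f y • partialFDeriv (partialFDeriv Ψ) (x, q y) :=
    hf.smul (hD.comp_continuous (by fun_prop) fun y => hVq x hx y)
  have hint : Integrable (fun y => f y • partialFDeriv (partialFDeriv Ψ) (x, q y)) ν :=
    hcont.integrable_of_hasCompactSupport (HasCompactSupport.of_compactSpace _)
  simp only [e2]
  refine ⟨(hint.apply_continuousLinearMap u).apply_continuousLinearMap v, ?_⟩
  rw [e1.fderiv_eq, (hasFDerivAt_integral_smul ν hO h1' hV hq hVq hf hx).fderiv,
    ContinuousLinearMap.integral_apply hint, ContinuousLinearMap.integral_apply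
    (hint.apply_continuousLinearMap u)]

end ParametricIntegral

/-! ### The Laplacian of radial functions -/

/-- A diagonal value of the second derivative, computed along a line. -/
lemma fderiv_fderiv_apply_self {E F : Type*} [NormedAddCommGroup E] [NormedSpace ℝ E]
    [NormedAddCommGroup F] [NormedSpace ℝ F] {f : E → F} {x v : E} (hf : ContDiffAt ℝ 2 f x)
    {d : ℝ → F} {d2 : F} (hd : ∀ᶠ t : ℝ in 𝓝 0, HasDerivAt (fun t : ℝ => f (x + t • v)) (d t) t)
    (hd2 : HasDerivAt d d2 0) : fderiv ℝ (fderiv ℝ f) x v v = d2 := by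
  have hline : ∀ t : ℝ, HasDerivAt (fun t : ℝ => x + t • v) v t := fun t => by
    simpa using ((hasDerivAt_id t).smul_const v).const_add x
  have hc : Tendsto (fun t : ℝ => x + t • v) (𝓝 0) (𝓝 x) := by
    simpa using (hline 0).continuousAt.tendsto
  have h1 : ∀ᶠ t : ℝ in 𝓝 0, d t = fderiv ℝ f (x + t • v) v := by
    filter_upwards [hd, hc.eventually (hf.eventually (by simp))] with t ht hft
    exact ht.unique ((hft.differentiableAt (by simp)).hasFDerivAt.comp_hasDerivAt t (hline t))
  have h2 : HasFDerivAt (fderiv ℝ f) (fderiv ℝ (fderiv ℝ f) x) (x + (0 : ℝ) • v) := by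
    rw [zero_smul, add_zero]
    exact ((hf.fderiv_right (m := 1) (by norm_num)).differentiableAt (by simp)).hasFDerivAt
  have h3 : HasDerivAt (fun t : ℝ => fderiv ℝ f (x + t • v) v)
      (fderiv ℝ (fderiv ℝ f) x v v) 0 := by
    have := h2.comp_hasDerivAt (0 : ℝ) (hline 0)
    simpa using this.clm_apply (hasDerivAt_const (0 : ℝ) v)
  exact (h3.congr_of_eventuallyEq h1).unique hd2

lemma laplacian_eq_fderiv_fderiv (f : ℂ → ℝ) (z : ℂ) :
    Laplacian.laplacian f z = fderiv ℝ (fderiv ℝ f) z 1 1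
      + fderiv ℝ (fderiv ℝ f) z Complex.I Complex.I := by
  rw [InnerProductSpace.laplacian_eq_iteratedFDeriv_complexPlane]
  simp [iteratedFDeriv_two_apply]

/-- The hyperbolic cosine of the hyperbolic distance, as a function of a pair of complex numbers
in the open upper half plane. -/
def coshDist (p : ℂ × ℂ) : ℝ := 1 + Complex.normSq (p.1 - p.2) / (2 * p.1.im * p.2.im)

lemma coshDist_coe (z w : ℍ) : coshDist (z, w) = Real.cosh (dist z w) := by
  rw [UpperHalfPlane.cosh_dist, coshDist, Complex.dist_eq, Complex.normSq_eq_norm_sq]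
  rfl

lemma contDiffOn_coshDist {n : WithTop ℕ∞} :
    ContDiffOn ℝ n coshDist ({z : ℂ | 0 < z.im} ×ˢ {z : ℂ | 0 < z.im}) := by
  have him : ContDiff ℝ n Complex.im := Complex.imCLM.contDiff
  have hre : ContDiff ℝ n Complex.re := Complex.reCLM.contDiff
  have hn : ContDiff ℝ n fun p : ℂ × ℂ => Complex.normSq (p.1 - p.2) := by
    simp only [Complex.normSq_apply]
    fun_prop
  unfold coshDist
  refine contDiffOn_const.add (hn.contDiffOn.div (by fun_prop) ?_)
  rintro ⟨a, b⟩ ⟨ha, hb⟩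
  have ha : 0 < a.im := ha
  have hb : 0 < b.im := hb
  positivity

/-- The hyperbolic Laplacian in the variable `c = cosh r` of functions of the distance `r`
to a fixed point. -/
def radialLaplacian (κ : ℝ → ℝ) (c : ℝ) : ℝ :=
  (c ^ 2 - 1) * deriv (deriv κ) c + 2 * c * deriv κ c

/-- The hyperbolic Laplacian of a function of the distance to `w`. -/
lemma laplacian_comp_coshDist {κ : ℝ → ℝ} (hκ : ContDiff ℝ 2 κ) {z w : ℂ} (hz : 0 < z.im)
    (hw : 0 < w.im) :
    z.im ^ 2 * Laplacian.laplacian (fun x => κ (coshDist (x, w))) z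
      = radialLaplacian κ (coshDist (z, w)) := by
  have hκ1 : ∀ c, HasDerivAt κ (deriv κ c) c := fun c =>
    (hκ.differentiable (by simp) c).hasDerivAt
  have hκ2 : ∀ c, HasDerivAt (deriv κ) (deriv (deriv κ) c) c := fun c =>
    ((hκ.iterate_deriv' 1 1).differentiable (by simp) c).hasDerivAt
  have hf : ContDiffAt ℝ 2 (fun x => κ (coshDist (x, w))) z := by
    have h1 : ContDiffAt ℝ 2 coshDist (z, w) := contDiffOn_coshDist.contDiffAt
      (((isOpen_lt continuous_const Complex.continuous_im).prod
        (isOpen_lt continuous_const Complex.continuous_im)).mem_nhds ⟨hz, hw⟩)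
    have h2 : ContDiffAt ℝ 2 (fun x : ℂ => (x, w)) z := contDiffAt_id.prodMk contDiffAt_const
    exact hκ.contDiffAt.comp z (ContDiffAt.comp z (g := coshDist) h1 h2)
  have hx : ∀ t : ℝ, HasDerivAt (fun t : ℝ => coshDist (z + t • (1 : ℂ), w))
      ((z.re + t - w.re) / (z.im * w.im)) t := by
    intro t
    have h : HasDerivAt (fun t : ℝ => 1 + ((z.re + t - w.re) ^ 2 + (z.im - w.im) ^ 2)
        / (2 * z.im * w.im)) ((2 * (z.re + t - w.re)) / (2 * z.im * w.im)) t := by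
      have h0 : HasDerivAt (fun t : ℝ => z.re + t - w.re) 1 t :=
        ((hasDerivAt_id t).const_add _).sub_const _
      have := (((h0.pow 2).add_const ((z.im - w.im) ^ 2)).div_const (2 * z.im * w.im)).const_add 1
      simpa using this
    convert h using 1
    · ext t
      simp [coshDist, Complex.normSq_apply]
      ring
    · field_simp
  have hy : ∀ᶠ t : ℝ in 𝓝 0, HasDerivAt (fun t : ℝ => coshDist (z + t • Complex.I, w))
      (1 / (2 * w.im) - ((z.re - w.re) ^ 2 + w.im ^ 2) / (2 * w.im) * ((z.im + t) ^ 2)⁻¹) t := by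
    have hct : Continuous fun t : ℝ => z.im + t := by fun_prop
    have : ∀ᶠ t : ℝ in 𝓝 0, 0 < z.im + t :=
      (hct.tendsto' 0 z.im (by simp)).eventually (lt_mem_nhds hz)
    filter_upwards [this] with t ht
    have h0 : HasDerivAt (fun t : ℝ => z.im + t) 1 t := (hasDerivAt_id t).const_add _
    have h : HasDerivAt (fun t : ℝ => 1 + ((z.re - w.re) ^ 2 + (z.im + t - w.im) ^ 2)
        / (2 * (z.im + t) * w.im)) ((2 * (z.im + t - w.im) * (2 * (z.im + t) * w.im)
          - ((z.re - w.re) ^ 2 + (z.im + t - w.im) ^ 2) * (2 * w.im))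
          / (2 * (z.im + t) * w.im) ^ 2) t := by
      have h1 := ((h0.sub_const w.im).pow 2).const_add ((z.re - w.re) ^ 2)
      have h2 := (h0.const_mul 2).mul_const w.im
      have := (h1.div h2 (by positivity)).const_add 1
      simpa using this
    convert h using 1
    · ext t
      simp [coshDist, Complex.normSq_apply]
      ring
    · field_simp
      ring
  have e1 : fderiv ℝ (fderiv ℝ fun x => κ (coshDist (x, w))) z 1 1
      = deriv (deriv κ) (coshDist (z, w)) * ((z.re - w.re) / (z.im * w.im)) ^ 2
        + deriv κ (coshDist (z, w)) * (1 / (z.im * w.im)) := by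
    refine fderiv_fderiv_apply_self (d := fun t => deriv κ (coshDist (z + t • (1 : ℂ), w)) *
      ((z.re + t - w.re) / (z.im * w.im))) hf (Eventually.of_forall fun t => ?_) ?_
    · exact (hκ1 _).comp t (hx t)
    · have h0 : HasDerivAt (fun t : ℝ => (z.re + t - w.re) / (z.im * w.im))
          (1 / (z.im * w.im)) 0 :=
        (((hasDerivAt_id (0 : ℝ)).const_add _).sub_const _).div_const _
      have := ((hκ2 _).comp (0 : ℝ) (hx 0)).mul h0
      refine this.congr_deriv ?_
      simp
      ring
  have e2 : fderiv ℝ (fderiv ℝ fun x => κ (coshDist (x, w))) z Complex.I Complex.I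
      = deriv (deriv κ) (coshDist (z, w)) *
        (1 / (2 * w.im) - ((z.re - w.re) ^ 2 + w.im ^ 2) / (2 * w.im) * (z.im ^ 2)⁻¹) ^ 2
        + deriv κ (coshDist (z, w)) * (((z.re - w.re) ^ 2 + w.im ^ 2) / (w.im * z.im ^ 3)) := by
    refine fderiv_fderiv_apply_self (d := fun t => deriv κ (coshDist (z + t • Complex.I, w)) *
      (1 / (2 * w.im) - ((z.re - w.re) ^ 2 + w.im ^ 2) / (2 * w.im) * ((z.im + t) ^ 2)⁻¹)) hf ?_ ?_
    · filter_upwards [hy] with t ht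
      exact (hκ1 _).comp t ht
    · have h0 : HasDerivAt (fun t : ℝ => 1 / (2 * w.im) - ((z.re - w.re) ^ 2 + w.im ^ 2)
          / (2 * w.im) * ((z.im + t) ^ 2)⁻¹)
          (((z.re - w.re) ^ 2 + w.im ^ 2) / (w.im * z.im ^ 3)) 0 := by
        have h1 : HasDerivAt (fun t : ℝ => z.im + t) 1 0 := (hasDerivAt_id (0 : ℝ)).const_add _
        have h2 := ((h1.pow 2).inv (by simpa using hz.ne')).const_mul
          (((z.re - w.re) ^ 2 + w.im ^ 2) / (2 * w.im)) |>.const_sub (1 / (2 * w.im))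
        refine h2.congr_deriv ?_
        simp
        field_simp
      have := ((hκ2 _).comp (0 : ℝ) hy.self_of_nhds).mul h0
      refine this.congr_deriv ?_
      simp
      ring
  rw [laplacian_eq_fderiv_fderiv, e1, e2, radialLaplacian]
  have hc : coshDist (z, w) = ((z.re - w.re) ^ 2 + z.im ^ 2 + w.im ^ 2) / (2 * z.im * w.im) := by
    simp only [coshDist, Complex.normSq_apply, Complex.sub_re, Complex.sub_im]
    field_simp
    ring
  generalize deriv (deriv κ) (coshDist (z, w)) = A
  generalize deriv κ (coshDist (z, w)) = B
  rw [hc]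
  field_simp
  ring

lemma radialLaplacian_eq_zero {κ : ℝ → ℝ} {c₀ : ℝ} (h : ∀ c, c₀ < c → κ c = 0) {c : ℝ}
    (hc : c₀ < c) : radialLaplacian κ c = 0 := by
  have h1 : ∀ c, c₀ < c → deriv κ c = 0 := fun c hc => by
    have : κ =ᶠ[𝓝 c] fun _ => 0 := by
      filter_upwards [lt_mem_nhds hc] with x hx using h x hx
    rw [this.deriv_eq, deriv_const]
  have h2 : deriv (deriv κ) c = 0 := by
    have : deriv κ =ᶠ[𝓝 c] fun _ => 0 := by
      filter_upwards [lt_mem_nhds hc] with x hx using h1 x hx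
    rw [this.deriv_eq, deriv_const]
  rw [radialLaplacian, h1 c hc, h2]
  ring

lemma continuous_radialLaplacian {κ : ℝ → ℝ} (hκ : ContDiff ℝ 2 κ) :
    Continuous (radialLaplacian κ) := by
  have h1 : Continuous (deriv κ) := hκ.continuous_deriv (by norm_num)
  have h2 : Continuous (deriv (deriv κ)) :=
    ((hκ.iterate_deriv' 1 1).continuous_deriv (by norm_num))
  unfold radialLaplacian
  fun_prop

/-! ### Isometries of the hyperbolic plane -/

lemma rho_eq_J_smul (z : ℍ) : rho z = UpperHalfPlane.J • z := by
  ext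
  rw [UpperHalfPlane.coe_J_smul]
  rfl

lemma coe_rho (z : ℍ) : (rho z : ℂ) = -(starRingEnd ℂ) (z : ℂ) := rfl

lemma rho_im (z : ℍ) : (rho z).im = z.im := by
  change (-(starRingEnd ℂ) (z : ℂ)).im = _
  simp

@[simp] lemma rho_rho (z : ℍ) : rho (rho z) = z := rho.left_inv z

lemma rho_inv : rho⁻¹ = rho := rfl

lemma rho_mul_rho : rho * rho = 1 := Equiv.ext rho_rho

lemma isometry_rho : Isometry rho := by
  refine Isometry.of_dist_eq fun z w => ?_
  have h : dist (rho z : ℂ) (rho w) = dist (z : ℂ) w := by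
    rw [coe_rho, coe_rho, dist_neg_neg, Complex.dist_conj_conj]
  rw [UpperHalfPlane.dist_eq, UpperHalfPlane.dist_eq, h, rho_im, rho_im]

lemma measurePreserving_rho : MeasurePreserving rho (volume : Measure ℍ) volume := by
  have := measurePreserving_smul UpperHalfPlane.J (volume : Measure ℍ)
  convert this using 1
  ext1 z
  exact rho_eq_J_smul z

lemma measurePreserving_SL_smul (g : SL(2, ℝ)) :
    MeasurePreserving (fun z : ℍ => g • z) volume volume :=
  measurePreserving_smul (Matrix.SpecialLinearGroup.mapGL ℝ g) (volume : Measure ℍ)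

/-- Any two points are exchanged by the half-turn about their midpoint. -/
lemma exists_SL_swap (z w : ℍ) : ∃ s : SL(2, ℝ), s • z = w ∧ s • w = z := by
  set a : ℝ := z.re * w.im + w.re * z.im with ha
  set c : ℝ := z.im + w.im with hc
  set b : ℝ := c * (z.re * w.re - z.im * w.im) - a * (z.re + w.re) with hb
  have hz := z.im_pos
  have hw := w.im_pos
  have hD : 0 < -(a ^ 2) - b * c := by
    have : -(a ^ 2) - b * c = z.im * w.im * ((z.re - w.re) ^ 2 + (z.im + w.im) ^ 2) := by
      rw [hb, ha, hc]; ring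
    rw [this]
    positivity
  set D := √(-(a ^ 2) - b * c) with hDdef
  have hD0 : 0 < D := Real.sqrt_pos.2 hD
  have hD2 : D ^ 2 = -(a ^ 2) - b * c := Real.sq_sqrt hD.le
  let s : SL(2, ℝ) := ⟨!![a / D, b / D; c / D, -a / D], by
    rw [Matrix.det_fin_two_of]
    field_simp
    rw [hD2]⟩
  have hDc : (D : ℂ) ≠ 0 := by exact_mod_cast hD0.ne'
  have key : ∀ u v : ℍ, (a : ℂ) * u + b = v * (c * u - a) → s • u = v := by
    intro u v huv
    have hden : (c : ℂ) * u - a ≠ 0 := by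
      intro h
      have : ((c : ℂ) * u - a).im = 0 := by rw [h]; rfl
      simp at this
      have : c ≠ 0 := by positivity
      have := u.im_ne_zero
      tauto
    ext
    rw [UpperHalfPlane.coe_specialLinearGroup_apply]
    simp only [s, Matrix.of_apply, Matrix.cons_val', Matrix.cons_val_zero, Matrix.cons_val_one,
      Matrix.cons_val_fin_one, Algebra.algebraMap_self, RingHom.id_apply,
      Complex.ofReal_div, Complex.ofReal_neg]
    have e1 : (a / D * u + b / D : ℂ) = (v * (c * u - a)) / D := by rw [← huv]; ring
    have e2 : (c / D * u + -a / D : ℂ) = (c * u - a) / D := by ring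
    rw [e1, e2]
    field_simp
  have h1 : (a : ℂ) * z + b = w * (c * z - a) := by
    apply Complex.ext
    · simp [ha, hb, hc]; ring
    · simp [ha, hb, hc]
      ring
  refine ⟨s, key z w h1, key w z ?_⟩
  linear_combination h1

lemma isOpenPosMeasure_volume : (volume : Measure ℍ).IsOpenPosMeasure := by
  refine ⟨fun U hU hne h0 => ?_⟩
  have hm : AEMeasurable (fun z : ℍ => ((((1 / NNReal.mk z.im z.im_pos.le : NNReal) ^ 2 : NNReal)) :
      ENNReal)) (Measure.comap UpperHalfPlane.coe volume) := by
    refine (ENNReal.continuous_coe.comp (.pow (.div₀ continuous_const ?_ ?_) _)).aemeasurable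
    · exact UpperHalfPlane.continuous_im.subtype_mk _
    · exact fun x => NNReal.ne_iff.mp x.im_ne_zero
  rw [UpperHalfPlane.volume_def, withDensity_apply_eq_zero' hm] at h0
  have h1 : {z : ℍ | ((((1 / NNReal.mk z.im z.im_pos.le : NNReal) ^ 2 : NNReal)) : ENNReal) ≠ 0}
      ∩ U = U := by
    refine inter_eq_right.2 fun z _ => ?_
    have : NNReal.mk z.im z.im_pos.le ≠ 0 := NNReal.ne_iff.mp z.im_ne_zero
    exact ENNReal.coe_ne_zero.2 (pow_ne_zero _ (one_div_ne_zero this))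
  rw [h1, UpperHalfPlane.measurableEmbedding_coe.comap_apply] at h0
  exact (UpperHalfPlane.isOpenEmbedding_coe.isOpenMap U hU).measure_ne_zero volume
    (hne.image _) h0

/-! ### Automorphic kernels -/

/-- A group of measure preserving isometries of the hyperbolic plane which acts properly
discontinuously and cocompactly, both expressed through the distance to the base point `i`. -/
structure IsCocompactIsometryGroup (G : Subgroup (Equiv.Perm ℍ)) : Prop where
  isometry : ∀ g ∈ G, Isometry g
  measurePreserving : ∀ g ∈ G, MeasurePreserving g (volume : Measure ℍ) volume
  finite : ∀ R : ℝ, {g : G | dist (g.1 UpperHalfPlane.I) UpperHalfPlane.I ≤ R}.Finite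
  cocompact : ∃ R : ℝ, ∀ z, ∃ g ∈ G, dist (g z) UpperHalfPlane.I ≤ R

variable {G : Subgroup (Equiv.Perm ℍ)}

/-- The kernel `∑ ε(g) κ(cosh d(z, g w))`, the sum running over the group, which transforms in both
variables according to the character `ε`. -/
def autoKernel (ε : G →* ℝ) (κ : ℝ → ℝ) (z w : ℍ) : ℝ :=
  ∑' g : G, ε g * κ (Real.cosh (dist z (g.1 w)))

namespace IsCocompactIsometryGroup

/-- The finite set of group elements moving the base point `i` by at most `R`. -/
def near (hG : IsCocompactIsometryGroup G) (R : ℝ) : Finset G := (hG.finite R).toFinset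

lemma lt_dist_of_notMem_near (hG : IsCocompactIsometryGroup G) {R : ℝ} {g : G}
    (hg : g ∉ hG.near R) : R < dist (g.1 UpperHalfPlane.I) UpperHalfPlane.I := by
  simpa [near] using hg

lemma dist_map (hG : IsCocompactIsometryGroup G) (g : G) (z w : ℍ) :
    dist (g.1 z) (g.1 w) = dist z w :=
  (hG.isometry g g.2).dist_eq z w

lemma dist_map_inv (hG : IsCocompactIsometryGroup G) (g : G) (z w : ℍ) :
    dist z (g⁻¹.1 w) = dist (g.1 z) w := by
  rw [← hG.dist_map g]
  simp

lemma continuous (hG : IsCocompactIsometryGroup G) (g : G) : Continuous g.1 :=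
  (hG.isometry g g.2).continuous

lemma integral_comp (hG : IsCocompactIsometryGroup G) (g : G) (f : ℍ → ℝ) :
    ∫ z, f (g.1 z) = ∫ z, f z :=
  (hG.measurePreserving g g.2).integral_comp
    (hG.isometry g g.2).isClosedEmbedding.measurableEmbedding f

/-- If `g` moves `i` by more than `a + b`, then it maps no point at distance at most `a` from `i`
to a point at distance at most `b` from `i`. -/
lemma lt_dist_map_of_notMem_near (hG : IsCocompactIsometryGroup G) {a b : ℝ} {g : G}
    (hg : g ∉ hG.near (a + b)) {z : ℍ} (hz : dist z UpperHalfPlane.I ≤ a) :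
    b < dist (g.1 z) UpperHalfPlane.I := by
  have h1 := hG.lt_dist_of_notMem_near hg
  have h2 := dist_triangle (g.1 UpperHalfPlane.I) (g.1 z) UpperHalfPlane.I
  rw [hG.dist_map, dist_comm _ z] at h2
  linarith

lemma kernel_eq_zero_of_notMem_near (hG : IsCocompactIsometryGroup G) {κ : ℝ → ℝ} {r : ℝ}
    (hr : 0 ≤ r) (hκ : ∀ c, Real.cosh r < c → κ c = 0) {R₁ R₂ : ℝ} {z w : ℍ}
    (hz : dist z UpperHalfPlane.I ≤ R₁) (hw : dist w UpperHalfPlane.I ≤ R₂) {g : G}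
    (hg : g ∉ hG.near (R₁ + R₂ + r)) : κ (Real.cosh (dist z (g.1 w))) = 0 := by
  apply hκ
  rw [Real.cosh_lt_cosh, abs_of_nonneg hr, abs_of_nonneg dist_nonneg]
  have h1 : R₁ + r < dist (g.1 w) UpperHalfPlane.I :=
    hG.lt_dist_map_of_notMem_near (a := R₂) (by rwa [show R₂ + (R₁ + r) = R₁ + R₂ + r by ring]) hw
  have h2 := dist_triangle_left (g.1 w) UpperHalfPlane.I z
  linarith

lemma autoKernel_eq_sum (hG : IsCocompactIsometryGroup G) (ε : G →* ℝ) {κ : ℝ → ℝ} {r : ℝ}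
    (hr : 0 ≤ r) (hκ : ∀ c, Real.cosh r < c → κ c = 0) {R₁ R₂ : ℝ} {z w : ℍ}
    (hz : dist z UpperHalfPlane.I ≤ R₁) (hw : dist w UpperHalfPlane.I ≤ R₂) :
    autoKernel ε κ z w = ∑ g ∈ hG.near (R₁ + R₂ + r), ε g * κ (Real.cosh (dist z (g.1 w))) :=
  tsum_eq_sum fun g hg => by rw [hG.kernel_eq_zero_of_notMem_near hr hκ hz hw hg, mul_zero]

lemma eventually_dist_le (z₀ : ℍ) :
    ∀ᶠ z in 𝓝 z₀, dist z UpperHalfPlane.I ≤ dist z₀ UpperHalfPlane.I + 1 := by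
  have h : Continuous fun z : ℍ => dist z UpperHalfPlane.I := by fun_prop
  exact (h.tendsto z₀).eventually_le_const (by linarith)

lemma continuous_autoKernel (hG : IsCocompactIsometryGroup G) (ε : G →* ℝ) {κ : ℝ → ℝ}
    (hκc : Continuous κ) {r : ℝ} (hr : 0 ≤ r) (hκ : ∀ c, Real.cosh r < c → κ c = 0) :
    Continuous fun p : ℍ × ℍ => autoKernel ε κ p.1 p.2 := by
  rw [continuous_iff_continuousAt]
  rintro ⟨z₀, w₀⟩
  have h : ∀ᶠ p : ℍ × ℍ in 𝓝 (z₀, w₀), autoKernel ε κ p.1 p.2 =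
      ∑ g ∈ hG.near ((dist z₀ UpperHalfPlane.I + 1) + (dist w₀ UpperHalfPlane.I + 1) + r),
        ε g * κ (Real.cosh (dist p.1 (g.1 p.2))) := by
    filter_upwards [(eventually_dist_le z₀).prod_inl_nhds w₀,
      (eventually_dist_le w₀).prod_inr_nhds z₀] with p h1 h2
    exact hG.autoKernel_eq_sum ε hr hκ h1 h2
  refine ContinuousAt.congr (Continuous.continuousAt ?_) (EventuallyEq.symm h)
  refine continuous_finsetSum _ fun g _ => continuous_const.mul (hκc.comp ?_)
  exact Real.continuous_cosh.comp (continuous_fst.dist ((hG.continuous g).comp continuous_snd))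

lemma autoKernel_map_left (hG : IsCocompactIsometryGroup G) (ε : G →* ℝ) (κ : ℝ → ℝ) (h : G)
    (z w : ℍ) : autoKernel ε κ (h.1 z) w = ε h * autoKernel ε κ z w := by
  unfold autoKernel
  rw [← (Equiv.mulLeft h).tsum_eq, ← tsum_mul_left]
  refine tsum_congr fun g => ?_
  change ε (h * g) * κ (Real.cosh (dist (h.1 z) (h.1 (g.1 w)))) = _
  rw [hG.dist_map, map_mul, mul_assoc]

lemma char_inv {ε : G →* ℝ} (hε : ∀ g, ε g * ε g = 1) (g : G) : ε g⁻¹ = ε g := by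
  have h : ε g⁻¹ * ε g = 1 := by rw [← map_mul, inv_mul_cancel, map_one]
  have h0 : ε g ≠ 0 := fun h0 => by simpa [h0] using hε g
  exact mul_right_cancel₀ h0 (h.trans (hε g).symm)

lemma autoKernel_comm (hG : IsCocompactIsometryGroup G) {ε : G →* ℝ} (hε : ∀ g, ε g * ε g = 1)
    (κ : ℝ → ℝ) (z w : ℍ) : autoKernel ε κ z w = autoKernel ε κ w z := by
  unfold autoKernel
  rw [← (Equiv.inv G).tsum_eq]
  refine tsum_congr fun g => ?_
  change ε g⁻¹ * κ (Real.cosh (dist z (g⁻¹.1 w))) = _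
  rw [hG.dist_map_inv, char_inv hε, dist_comm]

/-! ### Unfolding -/

lemma hasCompactSupport_of_dist {f : ℍ → ℝ} {R : ℝ}
    (h : ∀ z, R < dist z UpperHalfPlane.I → f z = 0) : HasCompactSupport f :=
  HasCompactSupport.intro (isCompact_closedBall UpperHalfPlane.I R) fun z hz =>
    h z (by simpa using hz)

/-- There is a compactly supported continuous weight whose translates add up to one. Integration
against it replaces integration over a fundamental domain. -/
lemma exists_weight (hG : IsCocompactIsometryGroup G) : ∃ (χ : ℍ → ℝ) (R : ℝ), Continuous χ ∧
    (∀ z, 0 ≤ χ z) ∧ (∀ z, R < dist z UpperHalfPlane.I → χ z = 0) ∧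
      ∀ z, ∑' g : G, χ (g.1 z) = 1 := by
  obtain ⟨R, hR⟩ := hG.cocompact
  set χ₀ : ℍ → ℝ := fun z => max 0 (R + 1 - dist z UpperHalfPlane.I) with hχ₀
  have hχ₀c : Continuous χ₀ := by fun_prop
  have hχ₀0 : ∀ z, 0 ≤ χ₀ z := fun z => le_max_left _ _
  have hχ₀s : ∀ z, R + 1 < dist z UpperHalfPlane.I → χ₀ z = 0 := fun z hz =>
    max_eq_left (by linarith)
  set S : ℍ → ℝ := fun z => ∑' g : G, χ₀ (g.1 z) with hS
  have hzero : ∀ {a : ℝ} {z : ℍ}, dist z UpperHalfPlane.I ≤ a → ∀ g ∉ hG.near (a + (R + 1)),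
      χ₀ (g.1 z) = 0 := fun hz g hg => hχ₀s _ (hG.lt_dist_map_of_notMem_near hg hz)
  have hSc : Continuous S := by
    rw [continuous_iff_continuousAt]
    intro z₀
    have h : ∀ᶠ z in 𝓝 z₀, S z =
        ∑ g ∈ hG.near ((dist z₀ UpperHalfPlane.I + 1) + (R + 1)), χ₀ (g.1 z) := by
      filter_upwards [eventually_dist_le z₀] with z hz using tsum_eq_sum (hzero hz)
    refine ContinuousAt.congr (Continuous.continuousAt ?_) (EventuallyEq.symm h)
    exact continuous_finsetSum _ fun g _ => hχ₀c.comp (hG.continuous g)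
  have hSpos : ∀ z, 0 < S z := fun z => by
    obtain ⟨g, hg, hgR⟩ := hR z
    have hsum : Summable fun g : G => χ₀ (g.1 z) :=
      summable_of_ne_finset_zero (s := hG.near (dist z UpperHalfPlane.I + (R + 1)))
        (hzero le_rfl)
    refine hsum.tsum_pos (fun g => hχ₀0 _) ⟨g, hg⟩ ?_
    exact lt_max_of_lt_right (by linarith)
  have hSinv : ∀ (h : G) (z : ℍ), S (h.1 z) = S z := fun h z =>
    (Equiv.mulRight h).tsum_eq (fun g : G => χ₀ (g.1 z))
  refine ⟨fun z => χ₀ z / S z, R + 1, hχ₀c.div hSc fun z => (hSpos z).ne', fun z =>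
    div_nonneg (hχ₀0 z) (hSpos z).le, fun z hz => by simp [hχ₀s z hz], fun z => ?_⟩
  simp only [hSinv]
  rw [tsum_div_const]
  exact div_self (hSpos z).ne'

/-- The unfolding identity `∑ ∫ χ(v) Φ(g v) dv = ∫ Φ`, the sum running over a finite part of the
group which carries all non-zero terms. -/
lemma sum_integral_weight_mul (hG : IsCocompactIsometryGroup G) {χ : ℍ → ℝ} {R : ℝ}
    (hχc : Continuous χ) (hχs : ∀ z, R < dist z UpperHalfPlane.I → χ z = 0)
    (hχ1 : ∀ z, ∑' g : G, χ (g.1 z) = 1) {Φ : ℍ → ℝ} (hΦc : Continuous Φ) {R' : ℝ}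
    (hΦs : ∀ z, R' < dist z UpperHalfPlane.I → Φ z = 0) :
    ∑ g ∈ hG.near (R + R'), ∫ v, χ v * Φ (g.1 v) = ∫ v, Φ v := by
  have h1 : ∀ g : G, ∫ v, χ v * Φ (g.1 v) = ∫ v, χ (g⁻¹.1 v) * Φ v := fun g => by
    rw [← hG.integral_comp g fun v => χ (g⁻¹.1 v) * Φ v]
    simp
  have hcs := hasCompactSupport_of_dist hΦs
  simp only [h1]
  rw [← integral_finsetSum]
  · refine integral_congr_ae (ae_of_all _ fun v => ?_)
    beta_reduce
    rw [← Finset.sum_mul]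
    by_cases hv : R' < dist v UpperHalfPlane.I
    · rw [hΦs v hv, mul_zero]
    · have h2 : ∑ g ∈ hG.near (R + R'), χ (g⁻¹.1 v) = 1 := by
        rw [← hχ1 v, ← (Equiv.inv G).tsum_eq]
        refine (tsum_eq_sum fun g hg => hχs _ ?_).symm
        rw [dist_comm, hG.dist_map_inv]
        have h3 := hG.lt_dist_of_notMem_near hg
        have h4 := dist_triangle (g.1 UpperHalfPlane.I) v UpperHalfPlane.I
        linarith
      rw [h2, one_mul]
  · intro g _
    exact ((hχc.comp (hG.continuous g⁻¹)).mul hΦc).integrable_of_hasCompactSupport hcs.mul_left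

lemma continuous_kernel_right {κ : ℝ → ℝ} (hκc : Continuous κ) (z : ℍ) :
    Continuous fun v : ℍ => κ (Real.cosh (dist z v)) := by fun_prop

lemma kernel_eq_zero_of_dist {κ : ℝ → ℝ} {r : ℝ} (hr : 0 ≤ r)
    (hκ : ∀ c, Real.cosh r < c → κ c = 0) {z v : ℍ}
    (hv : dist z UpperHalfPlane.I + r < dist v UpperHalfPlane.I) :
    κ (Real.cosh (dist z v)) = 0 := by
  apply hκ
  rw [Real.cosh_lt_cosh, abs_of_nonneg hr, abs_of_nonneg dist_nonneg]
  have := dist_triangle_left v UpperHalfPlane.I z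
  linarith

/-- Point-pair invariants commute under convolution, because any two points are exchanged by a
measure preserving isometry. -/
lemma integral_kernel_mul_kernel_comm (κ κ' : ℝ → ℝ) (z w : ℍ) :
    ∫ v, κ (Real.cosh (dist z v)) * κ' (Real.cosh (dist v w)) =
      ∫ v, κ' (Real.cosh (dist z v)) * κ (Real.cosh (dist v w)) := by
  obtain ⟨s, hs1, hs2⟩ := exists_SL_swap z w
  have hi : Isometry fun v : ℍ => s • v := isometry_smul ℍ s
  rw [← (measurePreserving_SL_smul s).integral_comp hi.isClosedEmbedding.measurableEmbedding]
  refine integral_congr_ae (ae_of_all _ fun v => ?_)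
  beta_reduce
  have h1 : dist z (s • v) = dist v w := by
    conv_lhs => rw [← hs2]
    rw [dist_smul, dist_comm]
  have h2 : dist (s • v) w = dist z v := by
    conv_lhs => rw [← hs1]
    rw [dist_smul, dist_comm]
  rw [h1, h2, mul_comm]

/-- The weighted composition of two automorphic kernels is an unweighted, hence symmetric,
expression in the underlying point-pair invariants. -/
lemma integral_weight_mul_autoKernel_mul (hG : IsCocompactIsometryGroup G) {ε : G →* ℝ}
    {κ κ' : ℝ → ℝ} (hκc : Continuous κ) (hκ'c : Continuous κ') {r : ℝ}
    (hr : 0 ≤ r) (hκ : ∀ c, Real.cosh r < c → κ c = 0) (hκ' : ∀ c, Real.cosh r < c → κ' c = 0)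
    {χ : ℍ → ℝ} {R : ℝ} (hχc : Continuous χ) (hχs : ∀ z, R < dist z UpperHalfPlane.I → χ z = 0)
    (hχ1 : ∀ z, ∑' g : G, χ (g.1 z) = 1) (z w : ℍ) :
    ∫ v, χ v * (autoKernel ε κ z v * autoKernel ε κ' v w) =
      ∑ h ∈ hG.near ((dist z UpperHalfPlane.I + r) + dist w UpperHalfPlane.I + r),
        ε h * ∫ v, κ (Real.cosh (dist z v)) * κ' (Real.cosh (dist v (h.1 w))) := by
  have hA'c : Continuous fun v => autoKernel ε κ' v w := by
    have h := hG.continuous_autoKernel ε hκ'c hr hκ'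
    fun_prop
  set Φ : ℍ → ℝ := fun v => κ (Real.cosh (dist z v)) * autoKernel ε κ' v w with hΦ
  have hΦc : Continuous Φ := (continuous_kernel_right hκc z).mul hA'c
  have hΦs : ∀ v, dist z UpperHalfPlane.I + r < dist v UpperHalfPlane.I → Φ v = 0 := fun v hv => by
    rw [hΦ]
    simp only [kernel_eq_zero_of_dist hr hκ hv, zero_mul]
  have hcs := hasCompactSupport_of_dist hχs
  have hleft : ∀ v, χ v * (autoKernel ε κ z v * autoKernel ε κ' v w) =
      ∑ g ∈ hG.near (R + (dist z UpperHalfPlane.I + r)), χ v * Φ (g.1 v) := by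
    intro v
    by_cases hv : R < dist v UpperHalfPlane.I
    · simp [hχs v hv]
    · have e := hG.autoKernel_eq_sum ε hr hκ (z := z) (w := v) le_rfl (not_lt.1 hv)
      rw [e, show dist z UpperHalfPlane.I + R + r = R + (dist z UpperHalfPlane.I + r) by ring,
        Finset.sum_mul, Finset.mul_sum]
      refine Finset.sum_congr rfl fun g _ => ?_
      simp only [hΦ, hG.autoKernel_map_left]
      ring
  have hright : ∀ v, Φ v = ∑ h ∈ hG.near ((dist z UpperHalfPlane.I + r)
      + dist w UpperHalfPlane.I + r),
        ε h * (κ (Real.cosh (dist z v)) * κ' (Real.cosh (dist v (h.1 w)))) := by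
    intro v
    by_cases hv : dist z UpperHalfPlane.I + r < dist v UpperHalfPlane.I
    · rw [hΦs v hv]
      simp [kernel_eq_zero_of_dist hr hκ hv]
    · have e := hG.autoKernel_eq_sum ε hr hκ' (z := v) (w := w) (not_lt.1 hv) le_rfl
      change _ * autoKernel ε κ' v w = _
      rw [e, Finset.mul_sum]
      exact Finset.sum_congr rfl fun h _ => by ring
  calc ∫ v, χ v * (autoKernel ε κ z v * autoKernel ε κ' v w)
      = ∑ g ∈ hG.near (R + (dist z UpperHalfPlane.I + r)), ∫ v, χ v * Φ (g.1 v) := by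
        simp only [hleft]
        refine integral_finsetSum _ fun g _ => ?_
        exact (hχc.mul (hΦc.comp (hG.continuous g))).integrable_of_hasCompactSupport hcs.mul_right
    _ = ∫ v, Φ v := hG.sum_integral_weight_mul hχc hχs hχ1 hΦc hΦs
    _ = _ := by
        simp only [hright, ← integral_const_mul]
        refine integral_finsetSum _ fun h _ => ?_
        refine Integrable.const_mul (Continuous.integrable_of_hasCompactSupport
          ((continuous_kernel_right hκc z).mul ?_) ?_) _
        · simp only [dist_comm _ (h.1 w)]
          exact continuous_kernel_right hκ'c _
        · exact (hasCompactSupport_of_dist fun v hv =>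
            kernel_eq_zero_of_dist hr hκ hv).mul_right

lemma integral_weight_mul_autoKernel_comm (hG : IsCocompactIsometryGroup G) {ε : G →* ℝ}
    {κ κ' : ℝ → ℝ} (hκc : Continuous κ) (hκ'c : Continuous κ') {r : ℝ}
    (hr : 0 ≤ r) (hκ : ∀ c, Real.cosh r < c → κ c = 0) (hκ' : ∀ c, Real.cosh r < c → κ' c = 0)
    {χ : ℍ → ℝ} {R : ℝ} (hχc : Continuous χ) (hχs : ∀ z, R < dist z UpperHalfPlane.I → χ z = 0)
    (hχ1 : ∀ z, ∑' g : G, χ (g.1 z) = 1) (z w : ℍ) :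
    ∫ v, χ v * (autoKernel ε κ z v * autoKernel ε κ' v w) =
      ∫ v, χ v * (autoKernel ε κ' z v * autoKernel ε κ v w) := by
  rw [hG.integral_weight_mul_autoKernel_mul hκc hκ'c hr hκ hκ' hχc hχs hχ1,
    hG.integral_weight_mul_autoKernel_mul hκ'c hκc hr hκ' hκ hχc hχs hχ1]
  simp only [integral_kernel_mul_kernel_comm κ κ']

end IsCocompactIsometryGroup

/-! ### Existence of eigenfunctions with a given character -/

lemma isOpen_im_pos : IsOpen {z : ℂ | 0 < z.im} := isOpen_lt continuous_const Complex.continuous_im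

lemma contDiffOn_comp_coshDist {n : ℕ} {κ : ℝ → ℝ} (hκ : ContDiff ℝ n κ) :
    ContDiffOn ℝ n (fun p => κ (coshDist p)) ({z : ℂ | 0 < z.im} ×ˢ {z : ℂ | 0 < z.im}) :=
  hκ.comp_contDiffOn contDiffOn_coshDist

section Smoothing

variable {X : Type*} [MetricSpace X] [CompactSpace X] [MeasurableSpace X] [BorelSpace X]
  (ν : Measure X) [IsFiniteMeasure ν]

lemma contDiffAt_integral_kernel {κ : ℝ → ℝ} (hκ : ContDiff ℝ 3 κ) {q : X → ℍ} (hq : Continuous q)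
    {f : X → ℝ} (hf : Continuous f) (z : ℍ) :
    ContDiffAt ℝ 2 (fun ζ : ℂ => ∫ y, f y • κ (coshDist (ζ, q y)) ∂ν) z := by
  have h := contDiffOn_integral_smul ν 2 (isOpen_im_pos.prod isOpen_im_pos)
    (contDiffOn_comp_coshDist (n := 3) (by exact_mod_cast hκ)) isOpen_im_pos
    (UpperHalfPlane.continuous_coe.comp hq) (fun x hx y => ⟨hx, (q y).im_pos⟩) hf
  exact ContDiffOn.contDiffAt (by exact_mod_cast h) (isOpen_im_pos.mem_nhds z.im_pos)

lemma laplacian_integral_kernel {κ : ℝ → ℝ} (hκ : ContDiff ℝ 3 κ) {q : X → ℍ} (hq : Continuous q)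
    {f : X → ℝ} (hf : Continuous f) (z : ℍ) :
    z.im ^ 2 * Laplacian.laplacian (fun ζ : ℂ => ∫ y, f y • κ (coshDist (ζ, q y)) ∂ν) z
      = ∫ y, f y * radialLaplacian κ (Real.cosh (dist z (q y))) ∂ν := by
  have hκ2 : ContDiff ℝ 2 κ := hκ.of_le (by norm_num)
  have h := fun v => fderiv_fderiv_integral_smul ν (isOpen_im_pos.prod isOpen_im_pos)
    (by exact_mod_cast contDiffOn_comp_coshDist (n := 2) (by exact_mod_cast hκ2)) isOpen_im_pos
    (UpperHalfPlane.continuous_coe.comp hq) (fun x hx y => ⟨hx, (q y).im_pos⟩) hf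
    (x := (z : ℂ)) z.im_pos v v
  have h1 := h 1
  have h2 := h Complex.I
  simp only [Function.comp_apply] at h1 h2
  rw [laplacian_eq_fderiv_fderiv, h1.2, h2.2, ← integral_add h1.1 h2.1, ← integral_const_mul]
  refine integral_congr_ae (ae_of_all _ fun y => ?_)
  beta_reduce
  rw [← coshDist_coe, ← laplacian_comp_coshDist hκ2 (z := (z : ℂ)) z.im_pos (q y).im_pos,
    laplacian_eq_fderiv_fderiv]
  simp only [smul_eq_mul]
  change z.im ^ 2 * _ = f y * (z.im ^ 2 * _)
  ring

end Smoothing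

lemma laplacian_sum_const_mul {ι : Type*} (s : Finset ι) (c : ι → ℝ) {H : ι → ℂ → ℝ} {z : ℂ}
    (hH : ∀ i, ContDiffAt ℝ 2 (H i) z) :
    Laplacian.laplacian (fun x => ∑ i ∈ s, c i * H i x) z
      = ∑ i ∈ s, c i * Laplacian.laplacian (H i) z := by
  classical
  induction s using Finset.induction_on with
  | empty => simp
  | insert i s hi ih =>
    simp only [Finset.sum_insert hi]
    have h1 : ContDiffAt ℝ 2 (c i • H i) z := (hH i).const_smul (c i)
    have h2 : ContDiffAt ℝ 2 (fun x => ∑ j ∈ s, c j * H j x) z :=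
      ContDiffAt.sum fun j _ => contDiffAt_const.mul (hH j)
    have h3 := h1.laplacian_add h2
    rw [InnerProductSpace.laplacian_smul (c i) (hH i), ih] at h3
    exact h3

lemma eventually_ofComplex {P : ℍ → Prop} {z : ℍ} (h : ∀ᶠ w in 𝓝 z, P w) :
    ∀ᶠ ζ : ℂ in 𝓝 (z : ℂ), P (UpperHalfPlane.ofComplex ζ) ∧
      (UpperHalfPlane.ofComplex ζ : ℂ) = ζ := by
  rw [← UpperHalfPlane.isOpenEmbedding_coe.map_nhds_eq, eventually_map]
  filter_upwards [h] with w hw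
  rw [UpperHalfPlane.ofComplex_apply]
  exact ⟨hw, rfl⟩

namespace IsCocompactIsometryGroup

variable {G : Subgroup (Equiv.Perm ℍ)}

section Smoothing

variable {X : Type*} [MetricSpace X] [CompactSpace X] [MeasurableSpace X] [BorelSpace X]
  (ν : Measure X) [IsFiniteMeasure ν]

/-- The automorphic integral operator with kernel `κ` produces `C²` functions, and composing it
with the Laplacian gives the automorphic integral operator with kernel `radialLaplacian κ`. -/
lemma contDiffAt_and_hypLaplacian_integral_autoKernel (hG : IsCocompactIsometryGroup G)
    (ε : G →* ℝ) {κ : ℝ → ℝ} (hκ : ContDiff ℝ 3 κ) {r : ℝ} (hr : 0 ≤ r)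
    (hκs : ∀ c, Real.cosh r < c → κ c = 0) {q : X → ℍ} (hq : Continuous q) {R : ℝ}
    (hqR : ∀ y, dist (q y) UpperHalfPlane.I ≤ R) {f : X → ℝ} (hf : Continuous f) (z : ℍ) :
    ContDiffAt ℝ 2 ((fun w : ℍ => ∫ y, autoKernel ε κ w (q y) * f y ∂ν) ∘
        UpperHalfPlane.ofComplex) z ∧
      hypLaplacian (fun w => ∫ y, autoKernel ε κ w (q y) * f y ∂ν) z =
        ∫ y, autoKernel ε (radialLaplacian κ) z (q y) * f y ∂ν := by
  set R₁ := dist z UpperHalfPlane.I + 1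
  set s := hG.near (R₁ + R + r) with hs
  set H : G → ℂ → ℝ := fun g ζ => ∫ y, f y • κ (coshDist (ζ, g.1 (q y))) ∂ν with hH
  have hHc : ∀ g, ContDiffAt ℝ 2 (H g) z := fun g =>
    contDiffAt_integral_kernel ν hκ ((hG.continuous g).comp hq) hf z
  have hexp : ∀ κ' : ℝ → ℝ, Continuous κ' → (∀ c, Real.cosh r < c → κ' c = 0) →
      ∀ w : ℍ, dist w UpperHalfPlane.I ≤ R₁ → ∫ y, autoKernel ε κ' w (q y) * f y ∂ν =
        ∑ g ∈ s, ε g * ∫ y, f y * κ' (Real.cosh (dist w (g.1 (q y)))) ∂ν := by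
    intro κ' hκ'c hκ' w hw
    simp only [hG.autoKernel_eq_sum ε hr hκ' hw (hqR _), Finset.sum_mul, ← integral_const_mul]
    rw [integral_finsetSum]
    · refine Finset.sum_congr rfl fun g _ => integral_congr_ae (ae_of_all _ fun y => ?_)
      beta_reduce
      ring
    · intro g _
      have hgc := hG.continuous g
      exact Continuous.integrable_of_hasCompactSupport (by fun_prop)
        (HasCompactSupport.of_compactSpace _)
  have hloc : ((fun w : ℍ => ∫ y, autoKernel ε κ w (q y) * f y ∂ν) ∘ UpperHalfPlane.ofComplex)
      =ᶠ[𝓝 (z : ℂ)] fun ζ => ∑ g ∈ s, ε g * H g ζ := by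
    filter_upwards [eventually_ofComplex (eventually_dist_le z)] with ζ hζ
    rw [Function.comp_apply, hexp κ hκ.continuous hκs _ hζ.1]
    refine Finset.sum_congr rfl fun g _ => ?_
    simp only [hH, ← coshDist_coe, hζ.2, smul_eq_mul]
  refine ⟨ContDiffAt.congr_of_eventuallyEq (ContDiffAt.sum fun g _ =>
    contDiffAt_const.mul (hHc g)) hloc, ?_⟩
  rw [hypLaplacian, (InnerProductSpace.laplacian_congr_nhds hloc).eq_of_nhds,
    laplacian_sum_const_mul s _ hHc, Finset.mul_sum,
    hexp _ (continuous_radialLaplacian (hκ.of_le (by norm_num)))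
      (fun c hc => radialLaplacian_eq_zero hκs hc) z (by simp [R₁])]
  refine Finset.sum_congr rfl fun g _ => ?_
  rw [← laplacian_integral_kernel ν hκ (q := fun y => g.1 (q y)) ((hG.continuous g).comp hq) hf z]
  ring

end Smoothing

/-- Around a point `z₀`, all group elements of small displacement fix `z₀`. -/
lemma exists_pos_lt_dist (hG : IsCocompactIsometryGroup G) (z₀ : ℍ) :
    ∃ r > 0, ∀ g : G, g.1 z₀ ≠ z₀ → r < dist z₀ (g.1 z₀) := by
  set d := dist z₀ UpperHalfPlane.I
  have h1 : ∀ᶠ r : ℝ in 𝓝[>] 0, ∀ g ∈ hG.near (d + (d + 1)),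
      g.1 z₀ ≠ z₀ → r < dist z₀ (g.1 z₀) := by
    rw [Filter.eventually_all_finset]
    intro g _
    by_cases hg : g.1 z₀ = z₀
    · simp [hg]
    · have : 0 < dist z₀ (g.1 z₀) := dist_pos.2 (Ne.symm hg)
      filter_upwards [nhdsWithin_le_nhds (gt_mem_nhds this)] with r hr _ using hr
  have h2 : ∀ᶠ r : ℝ in 𝓝[>] 0, r < 1 := nhdsWithin_le_nhds (gt_mem_nhds one_pos)
  obtain ⟨r, ⟨hr1, hr2⟩, hr0⟩ := ((h1.and h2).and self_mem_nhdsWithin).exists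
  refine ⟨r, hr0, fun g hg => ?_⟩
  by_cases hgn : g ∈ hG.near (d + (d + 1))
  · exact hr1 g hgn hg
  · have h3 := hG.lt_dist_map_of_notMem_near hgn (z := z₀) le_rfl
    have h4 := dist_triangle_left (g.1 z₀) UpperHalfPlane.I z₀
    have h5 : d + 1 ≤ dist z₀ (g.1 z₀) + d := h3.le.trans h4
    linarith

/-- If the isotropy group of some point `z₀` lies in the kernel of `ε`, then there is a non-zero
Laplace eigenfunction which transforms according to `ε`. The kernel is chosen to be supported so
close to the diagonal that its value at `(z₀, z₀)` only sees the isotropy group. -/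
theorem exists_eigenfunction (hG : IsCocompactIsometryGroup G) {ε : G →* ℝ}
    (hε : ∀ g, ε g * ε g = 1) (z₀ : ℍ) (hz₀ : ∀ g : G, g.1 z₀ = z₀ → ε g = 1) :
    ∃ (F : ℍ → ℝ) (μ : ℝ), ContDiffOn ℝ 2 (F ∘ UpperHalfPlane.ofComplex) {z : ℂ | 0 < z.im} ∧
      (∀ z, hypLaplacian F z = μ * F z) ∧ (∀ (g : G) z, F (g.1 z) = ε g * F z) ∧ ∃ z, F z ≠ 0 := by
  obtain ⟨r, hr, hrdist⟩ := hG.exists_pos_lt_dist z₀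
  set κ : ℝ → ℝ := fun c => Real.smoothTransition (Real.cosh r - c) with hκdef
  have hκ : ContDiff ℝ 3 κ := Real.smoothTransition.contDiff.comp (contDiff_const.sub contDiff_id)
  have hκs : ∀ c, Real.cosh r < c → κ c = 0 := fun c hc =>
    Real.smoothTransition.zero_of_nonpos (by linarith)
  set κ' := radialLaplacian κ with hκ'def
  have hκ'c : Continuous κ' := continuous_radialLaplacian (hκ.of_le (by norm_num))
  have hκ's : ∀ c, Real.cosh r < c → κ' c = 0 := fun c hc => radialLaplacian_eq_zero hκs hc
  have hA0 : autoKernel ε κ z₀ z₀ ≠ 0 := by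
    rw [hG.autoKernel_eq_sum ε hr.le hκs le_rfl le_rfl]
    refine (Finset.sum_pos' (fun g _ => ?_) ⟨1, ?_, ?_⟩).ne'
    · by_cases hg : g.1 z₀ = z₀
      · rw [hz₀ g hg, one_mul]
        exact Real.smoothTransition.nonneg _
      · rw [hκs, mul_zero]
        rw [Real.cosh_lt_cosh, abs_of_pos hr, abs_of_nonneg dist_nonneg]
        exact hrdist g hg
    · simp only [near, Set.Finite.mem_toFinset, Set.mem_ofPred_eq]
      simp
      positivity
    · rw [map_one, one_mul]
      refine Real.smoothTransition.pos_of_pos ?_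
      simp [hr.ne']
  obtain ⟨χ, R, hχc, hχ0, hχs, hχ1⟩ := hG.exists_weight
  have hmeet : ∀ z, ∃ g : G, χ (g.1 z) ≠ 0 := by
    intro z
    by_contra! h
    simpa [h] using hχ1 z
  have hχR : ∀ z, χ z ≠ 0 → dist z UpperHalfPlane.I ≤ R := fun z hz => by
    by_contra! h
    exact hz (hχs z h)
  -- the compact set carrying the weight, with the weighted area
  let X := Metric.closedBall (UpperHalfPlane.I) R
  have hXc : CompactSpace X := isCompact_iff_compactSpace.1 (isCompact_closedBall _ _)
  have hXm : MeasurableSet X := Metric.isClosed_closedBall.measurableSet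
  let ν₀ : Measure X := (volume : Measure ℍ).comap Subtype.val
  have hν₀ : IsFiniteMeasure ν₀ := ⟨by
    rw [(MeasurableEmbedding.subtype_coe hXm).comap_apply, image_univ, Subtype.range_coe]
    exact (isCompact_closedBall _ _).measure_lt_top⟩
  let ρ : X → NNReal := fun x => (χ x).toNNReal
  have hρc : Continuous ρ := continuous_real_toNNReal.comp (hχc.comp continuous_subtype_val)
  let ν : Measure X := ν₀.withDensity fun x => (ρ x : ENNReal)
  have hν : IsFiniteMeasure ν := by
    obtain ⟨M, hM⟩ := (isCompact_range hρc).bddAbove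
    refine isFiniteMeasure_withDensity (ne_of_lt ?_)
    calc ∫⁻ x, (ρ x : ENNReal) ∂ν₀ ≤ ∫⁻ x, (M : ENNReal) ∂ν₀ :=
          lintegral_mono fun x => ENNReal.coe_le_coe.2 (hM ⟨x, rfl⟩)
      _ < ⊤ := by
          rw [lintegral_const]
          exact ENNReal.mul_lt_top ENNReal.coe_lt_top (measure_lt_top _ _)
  have hint : ∀ g : ℍ → ℝ, ∫ x : X, g x ∂ν = ∫ v, χ v * g v := by
    intro g
    have h1 : ∫ x : X, g x ∂ν = ∫ x : X, χ x * g x ∂ν₀ := by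
      rw [integral_withDensity_eq_integral_smul hρc.measurable]
      refine integral_congr_ae (ae_of_all _ fun x => ?_)
      simp [ρ, NNReal.smul_def, hχ0]
    rw [h1, integral_subtype_comap hXm fun v => χ v * g v]
    refine setIntegral_eq_integral_of_forall_compl_eq_zero fun v hv => ?_
    have hv' : R < dist v UpperHalfPlane.I := by simpa [X] using hv
    rw [hχs v hv', zero_mul]
  have hνpos : ∀ x₀ : X, χ x₀ ≠ 0 → ∀ U ∈ 𝓝 x₀, ν U ≠ 0 := by
    intro x₀ hx₀ U hU h0
    have := isOpenPosMeasure_volume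
    rw [withDensity_apply_eq_zero' (by fun_prop),
      (MeasurableEmbedding.subtype_coe hXm).comap_apply] at h0
    obtain ⟨V, hV, hVU⟩ := mem_nhds_subtype X x₀ U |>.1 hU
    have hV2 : V ∩ {v | χ v ≠ 0} ∈ 𝓝 (x₀ : ℍ) :=
      inter_mem hV (hχc.continuousAt.eventually_ne hx₀)
    refine (Measure.measure_pos_of_mem_nhds volume hV2).ne' (measure_mono_null ?_ h0)
    rintro v ⟨hv1, hv2⟩
    refine ⟨⟨v, hχR v hv2⟩, ⟨?_, hVU hv1⟩, rfl⟩
    have : 0 < χ v := lt_of_le_of_ne (hχ0 v) (Ne.symm hv2)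
    simpa [ρ] using this
  have hAc := hG.continuous_autoKernel ε hκ.continuous hr.le hκs
  have hA'c := hG.continuous_autoKernel ε hκ'c hr.le hκ's
  let K : C(X × X, ℝ) := ⟨fun p => autoKernel ε κ p.1 p.2, by fun_prop⟩
  let K' : C(X × X, ℝ) := ⟨fun p => autoKernel ε κ' p.1 p.2, by fun_prop⟩
  obtain ⟨g₀, hg₀⟩ := hmeet z₀
  obtain ⟨f, a, b, hfc, ha, ⟨x₁, hx₁⟩, hfa, hfb⟩ := exists_common_eigenfunction ν K K'
    (fun x y => hG.autoKernel_comm hε κ x y) (fun x y => hG.autoKernel_comm hε κ' x y)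
    (fun x z => by
      change ∫ y : X, autoKernel ε κ x y * autoKernel ε κ' y z ∂ν =
        ∫ y : X, autoKernel ε κ' x y * autoKernel ε κ y z ∂ν
      rw [hint fun v => autoKernel ε κ x v * autoKernel ε κ' v z,
        hint fun v => autoKernel ε κ' x v * autoKernel ε κ v z]
      exact hG.integral_weight_mul_autoKernel_comm hκ.continuous hκ'c hr.le hκs hκ's hχc hχs hχ1
        _ _)
    ⟨g₀.1 z₀, hχR _ hg₀⟩ (by
      change autoKernel ε κ (g₀.1 z₀) (g₀.1 z₀) ≠ 0
      rw [hG.autoKernel_map_left, hG.autoKernel_comm hε, hG.autoKernel_map_left, ← mul_assoc, hε,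
        one_mul]
      exact hA0) (hνpos _ hg₀)
  set F : ℍ → ℝ := fun z => ∫ y : X, autoKernel ε κ z y * f y ∂ν with hF
  have hreg := fun z => hG.contDiffAt_and_hypLaplacian_integral_autoKernel ν ε hκ hr.le hκs
    (q := fun y : X => (y : ℍ)) continuous_subtype_val (R := R) (fun y => y.2) hfc z
  have hFeq : ∀ (g : G) z, F (g.1 z) = ε g * F z := fun g z => by
    simp only [hF, hG.autoKernel_map_left, mul_assoc, integral_const_mul]
  have hFX : ∀ x : X, F x = a * f x := hfa
  refine ⟨F, b / a, fun ζ hζ => ?_, fun z => ?_, hFeq, x₁, ?_⟩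
  · exact (hreg ⟨ζ, hζ⟩).1.contDiffWithinAt
  · obtain ⟨g, hg⟩ := hmeet z
    have h1 : ∫ y : X, autoKernel ε κ' (g.1 z) y * f y ∂ν
        = b * f ⟨g.1 z, hχR _ hg⟩ := hfb ⟨g.1 z, hχR _ hg⟩
    have h2 : F (g.1 z) = a * f ⟨g.1 z, hχR _ hg⟩ := hFX ⟨g.1 z, hχR _ hg⟩
    have h3 : ε g * ∫ y : X, autoKernel ε κ' z y * f y ∂ν = ε g * (b / a * F z) := by
      calc ε g * ∫ y : X, autoKernel ε κ' z y * f y ∂ν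
          = ∫ y : X, autoKernel ε κ' (g.1 z) y * f y ∂ν := by
            simp only [hG.autoKernel_map_left, mul_assoc, integral_const_mul]
        _ = b / a * F (g.1 z) := by rw [h1, h2]; field_simp
        _ = ε g * (b / a * F z) := by rw [hFeq]; ring
    have h0 : ε g ≠ 0 := fun h0 => by simpa [h0] using hε g
    rw [(hreg z).2]
    exact mul_left_cancel₀ h0 h3
  · rw [hFX]
    exact mul_ne_zero ha hx₁

end IsCocompactIsometryGroup

/-! ### The group generated by a cocompact group and the reflection -/

lemma mem_transf {Γ : Subgroup SL(2, ℝ)} {p : Equiv.Perm ℍ} :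
    p ∈ transf Γ ↔ ∃ g ∈ Γ, ∀ z, p z = g • z := by
  constructor
  · rintro ⟨g, hg, rfl⟩
    exact ⟨g, hg, fun z => rfl⟩
  · rintro ⟨g, hg, h⟩
    exact ⟨g, hg, Equiv.ext fun z => (h z).symm⟩

lemma SL_det (g : SL(2, ℝ)) : g 0 0 * g 1 1 - g 0 1 * g 1 0 = 1 := by
  rw [← Matrix.det_fin_two]
  exact g.det_coe

/-- Conjugation by the reflection changes the signs of the off-diagonal entries. -/
lemma exists_SL_smul_eq_rho_conj (g : SL(2, ℝ)) :
    ∃ g' : SL(2, ℝ), ∀ z : ℍ, g' • z = rho (g • rho z) := by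
  let g' : SL(2, ℝ) := ⟨!![g 0 0, -g 0 1; -g 1 0, g 1 1], by
    rw [Matrix.det_fin_two_of]
    linarith [SL_det g]⟩
  refine ⟨g', fun z => ?_⟩
  · ext
    rw [coe_rho, UpperHalfPlane.coe_specialLinearGroup_apply,
      UpperHalfPlane.coe_specialLinearGroup_apply, coe_rho]
    have h1 : (g 1 0 : ℂ) * -(starRingEnd ℂ) (z : ℂ) + g 1 1 ≠ 0 := by
      have := UpperHalfPlane.denom_ne_zero (Matrix.SpecialLinearGroup.mapGL ℝ g) (rho z)
      simpa [UpperHalfPlane.denom, coe_rho] using this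
    have h2 : -(g 1 0 : ℂ) * (z : ℂ) + g 1 1 ≠ 0 := by
      intro h
      apply h1
      have := congrArg (starRingEnd ℂ) h
      simp at this
      linear_combination this
    simp only [g', Matrix.of_apply, Matrix.cons_val', Matrix.cons_val_zero, Matrix.cons_val_one,
      Matrix.cons_val_fin_one, Algebra.algebraMap_self, RingHom.id_apply, Complex.ofReal_neg,
      map_div₀, map_add, map_mul, map_neg, Complex.conj_ofReal, Complex.conj_conj]
    rw [← neg_div]
    congr 1 <;> ring

lemma mem_rhoConj {Γ : Subgroup SL(2, ℝ)} {p : Equiv.Perm ℍ} :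
    p ∈ rhoConj Γ ↔ rho * p * rho ∈ transf Γ := by
  constructor
  · rintro ⟨q, hq, rfl⟩
    have : rho * (MulAut.conj rho⁻¹).toMonoidHom q * rho = q := by
      ext1 z
      simp [rho_inv]
    rwa [this]
  · intro h
    refine ⟨_, h, ?_⟩
    ext1 z
    simp [rho_inv]

lemma exists_SL_of_mem_symmGroup {Γ : Subgroup SL(2, ℝ)} {p : Equiv.Perm ℍ}
    (hp : p ∈ symmGroup Γ) : ∃ g : SL(2, ℝ), ∀ z, p z = g • z := by
  have h : symmGroup Γ ≤ (MulAction.toPermHom SL(2, ℝ) ℍ).range := by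
    refine sup_le ?_ ?_
    · rintro _ ⟨g, -, rfl⟩
      exact ⟨g, rfl⟩
    · intro q hq
      obtain ⟨g, -, hg⟩ := mem_transf.1 (mem_rhoConj.1 hq)
      obtain ⟨g', hg'⟩ := exists_SL_smul_eq_rho_conj g
      refine ⟨g', Equiv.ext fun z => ?_⟩
      change g' • z = q z
      rw [hg', ← hg]
      simp
  obtain ⟨g, rfl⟩ := h hp
  exact ⟨g, fun z => rfl⟩

lemma rho_conj_mem_symmGroup {Γ : Subgroup SL(2, ℝ)} {p : Equiv.Perm ℍ} (hp : p ∈ symmGroup Γ) :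
    rho * p * rho ∈ symmGroup Γ := by
  have h : symmGroup Γ ≤ (symmGroup Γ).comap (MulAut.conj rho).toMonoidHom := by
    refine sup_le (fun q hq => ?_) fun q hq => ?_
    · refine Subgroup.mem_sup_right (mem_rhoConj.2 ?_)
      convert hq using 1
      ext1 z
      simp [rho_inv]
    · exact Subgroup.mem_sup_left (mem_rhoConj.1 hq)
  exact h hp

/-- The group generated by `symmGroup Γ` and the reflection, which normalizes `symmGroup Γ`. -/
def reflGroup (Γ : Subgroup SL(2, ℝ)) : Subgroup (Equiv.Perm ℍ) where
  carrier := {p | p ∈ symmGroup Γ ∨ p * rho ∈ symmGroup Γ}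
  one_mem' := Or.inl (one_mem _)
  mul_mem' := by
    rintro p q (hp | hp) (hq | hq)
    · exact Or.inl (mul_mem hp hq)
    · exact Or.inr (by rw [mul_assoc]; exact mul_mem hp hq)
    · refine Or.inr ?_
      have : p * q * rho = p * rho * (rho * q * rho) := by
        ext1 z; simp
      rw [this]
      exact mul_mem hp (rho_conj_mem_symmGroup hq)
    · refine Or.inl ?_
      have : p * q = p * rho * (rho * (q * rho) * rho) := by
        ext1 z; simp
      rw [this]
      exact mul_mem hp (rho_conj_mem_symmGroup hq)
  inv_mem' := by
    rintro p (hp | hp)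
    · exact Or.inl (inv_mem hp)
    · refine Or.inr ?_
      have : p⁻¹ * rho = rho * (p * rho)⁻¹ * rho := by
        ext1 z; simp [mul_inv_rev, rho_inv]
      rw [this]
      exact rho_conj_mem_symmGroup (inv_mem hp)

lemma symmGroup_le_reflGroup (Γ : Subgroup SL(2, ℝ)) : symmGroup Γ ≤ reflGroup Γ :=
  fun _ hp => Or.inl hp

lemma rho_mem_reflGroup (Γ : Subgroup SL(2, ℝ)) : rho ∈ reflGroup Γ :=
  Or.inr (by rw [rho_mul_rho]; exact one_mem _)

open scoped Classical in
/-- The character of `reflGroup Γ` which is `1` on `symmGroup Γ` and `-1` elsewhere. -/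
def reflChar (Γ : Subgroup SL(2, ℝ)) : reflGroup Γ →* ℝ where
  toFun p := if p.1 ∈ symmGroup Γ then 1 else -1
  map_one' := if_pos (one_mem _)
  map_mul' := by
    rintro ⟨p, hp⟩ ⟨q, hq⟩
    change (if p * q ∈ symmGroup Γ then (1 : ℝ) else -1) =
      (if p ∈ symmGroup Γ then 1 else -1) * (if q ∈ symmGroup Γ then 1 else -1)
    by_cases h1 : p ∈ symmGroup Γ
    · simp [h1, Subgroup.mul_mem_cancel_left _ h1]
    · by_cases h2 : q ∈ symmGroup Γ
      · simp [h1, h2, Subgroup.mul_mem_cancel_right _ h2]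
      · have h3 : p * q ∈ symmGroup Γ := by
          have : p * q = p * rho * (rho * (q * rho) * rho) := by
            ext1 z; simp
          rw [this]
          exact mul_mem (hp.resolve_left h1) (rho_conj_mem_symmGroup (hq.resolve_left h2))
        simp [h1, h2, h3]

lemma reflChar_of_mem {Γ : Subgroup SL(2, ℝ)} {p : reflGroup Γ} (hp : p.1 ∈ symmGroup Γ) :
    reflChar Γ p = 1 := if_pos hp

lemma reflChar_of_notMem {Γ : Subgroup SL(2, ℝ)} {p : reflGroup Γ} (hp : p.1 ∉ symmGroup Γ) :
    reflChar Γ p = -1 := if_neg hp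

/-- If the quotient is compact, some closed ball about `i` meets every orbit. -/
lemma exists_dist_smul_le (Γ : Subgroup SL(2, ℝ))
    [CompactSpace (MulAction.orbitRel.Quotient Γ ℍ)] :
    ∃ R : ℝ, ∀ z : ℍ, ∃ g ∈ Γ, dist (g • z) UpperHalfPlane.I ≤ R := by
  let π : ℍ → MulAction.orbitRel.Quotient Γ ℍ := Quotient.mk (MulAction.orbitRel Γ ℍ)
  have hπ : IsOpenMap π := isOpenMap_quotient_mk'_mul
  obtain ⟨n, hn⟩ := isCompact_univ.elim_directed_cover
    (fun n : ℕ => π '' Metric.ball UpperHalfPlane.I n) (fun n => hπ _ Metric.isOpen_ball)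
    (by
      rintro ⟨z⟩ -
      obtain ⟨n, hn⟩ := exists_nat_gt (dist z UpperHalfPlane.I)
      exact mem_iUnion.2 ⟨n, z, hn, rfl⟩)
    (Monotone.directed_le fun m n hmn => image_mono
      (Metric.ball_subset_ball (by exact_mod_cast hmn)))
  refine ⟨n, fun z => ?_⟩
  obtain ⟨w, hw, hwz⟩ := hn (mem_univ (π z))
  have h : (MulAction.orbitRel Γ ℍ) w z := Quotient.exact hwz
  rw [MulAction.orbitRel_apply] at h
  obtain ⟨g, rfl⟩ := h
  exact ⟨g, g.2, (Metric.mem_ball.1 hw).le⟩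

lemma finite_setOf_dist_transf_le (Γ : Subgroup SL(2, ℝ)) [DiscreteTopology Γ] (R : ℝ) :
    {p | p ∈ transf Γ ∧ dist (p UpperHalfPlane.I) UpperHalfPlane.I ≤ R}.Finite := by
  have h := ProperlyDiscontinuousSMul.finite_disjoint_inter_image (Γ := Γ)
    (isCompact_singleton (x := (UpperHalfPlane.I : ℍ)))
    (isCompact_closedBall (UpperHalfPlane.I : ℍ) R)
  refine (h.image fun g : Γ => MulAction.toPermHom SL(2, ℝ) ℍ g).subset ?_
  rintro _ ⟨⟨g, hg, rfl⟩, hgR⟩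
  refine ⟨⟨g, hg⟩, ⟨g • UpperHalfPlane.I, ⟨_, rfl, rfl⟩, hgR⟩, rfl⟩

lemma exists_finite_transversal_of_finiteIndex {A : Type*} [Group A] {N H : Subgroup A}
    (h : (N.subgroupOf H).FiniteIndex) : ∃ T : Set A, T.Finite ∧ T ⊆ H ∧
      ∀ p ∈ H, ∃ t ∈ T, p * t⁻¹ ∈ N := by
  have : Finite (H ⧸ N.subgroupOf H) := Subgroup.finite_quotient_of_finiteIndex
  refine ⟨range fun c : H ⧸ N.subgroupOf H => ((Quotient.out c)⁻¹ : H).1, finite_range _, ?_,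
    fun p hp => ⟨_, ⟨QuotientGroup.mk (⟨p, hp⟩ : H)⁻¹, rfl⟩, ?_⟩⟩
  · rintro _ ⟨c, rfl⟩
    exact SetLike.coe_mem _
  · have h1 : (QuotientGroup.mk (Quotient.out (QuotientGroup.mk (⟨p, hp⟩ : H)⁻¹ :
        H ⧸ N.subgroupOf H)) : H ⧸ N.subgroupOf H) = QuotientGroup.mk (⟨p, hp⟩ : H)⁻¹ :=
      QuotientGroup.out_eq' _
    rw [eq_comm, QuotientGroup.eq, Subgroup.mem_subgroupOf] at h1
    simpa using h1

lemma isCocompactIsometryGroup_reflGroup (Γ : Subgroup SL(2, ℝ)) [DiscreteTopology Γ]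
    [CompactSpace (MulAction.orbitRel.Quotient Γ ℍ)]
    (h : ((transf Γ).subgroupOf (symmGroup Γ)).FiniteIndex) :
    IsCocompactIsometryGroup (reflGroup Γ) := by
  have hiso : ∀ p ∈ symmGroup Γ, Isometry p := fun p hp => by
    obtain ⟨g, hg⟩ := exists_SL_of_mem_symmGroup hp
    rw [show (p : ℍ → ℍ) = fun z => g • z from funext hg]
    exact isometry_smul ℍ g
  have hmp : ∀ p ∈ symmGroup Γ, MeasurePreserving p (volume : Measure ℍ) volume := fun p hp => by
    obtain ⟨g, hg⟩ := exists_SL_of_mem_symmGroup hp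
    rw [show (p : ℍ → ℍ) = fun z => g • z from funext hg]
    exact measurePreserving_SL_smul g
  have hrho : ∀ p : Equiv.Perm ℍ, (p : ℍ → ℍ) = (p * rho : Equiv.Perm ℍ) ∘ rho := fun p => by
    ext1 z
    simp
  have hrhoI : rho UpperHalfPlane.I = UpperHalfPlane.I := by
    ext
    simp [coe_rho]
  refine ⟨?_, ?_, fun R => ?_, ?_⟩
  · rintro p (hp | hp)
    · exact hiso p hp
    · rw [hrho]
      exact (hiso _ hp).comp isometry_rho
  · rintro p (hp | hp)
    · exact hmp p hp
    · rw [hrho]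
      exact (hmp _ hp).comp measurePreserving_rho
  · obtain ⟨T, hT, hTH, hcov⟩ := exists_finite_transversal_of_finiteIndex h
    -- the elements of `symmGroup Γ` of bounded displacement lie in finitely many cosets
    have h1 : {p | p ∈ symmGroup Γ ∧ dist (p UpperHalfPlane.I) UpperHalfPlane.I ≤ R}.Finite := by
      refine (hT.biUnion fun t _ => (finite_setOf_dist_transf_le Γ
        (dist (t UpperHalfPlane.I) UpperHalfPlane.I + R)).image fun q => q * t).subset ?_
      rintro p ⟨hp, hpR⟩
      obtain ⟨t, ht, hpt⟩ := hcov p hp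
      refine mem_biUnion ht ⟨p * t⁻¹, ⟨hpt, ?_⟩, by simp⟩
      have h2 : Isometry (p * t⁻¹ : Equiv.Perm ℍ) :=
        hiso _ (mul_mem hp (inv_mem (hTH ht)))
      have h3 := h2.dist_eq UpperHalfPlane.I (t UpperHalfPlane.I)
      have h4 : (p * t⁻¹ : Equiv.Perm ℍ) (t UpperHalfPlane.I) = p UpperHalfPlane.I := by simp
      rw [h4, dist_comm (UpperHalfPlane.I : ℍ)] at h3
      rw [← h3]
      exact (dist_triangle _ (p UpperHalfPlane.I) _).trans (by gcongr)
    have h2 : {p | p ∈ reflGroup Γ ∧ dist (p UpperHalfPlane.I) UpperHalfPlane.I ≤ R}.Finite := by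
      refine (h1.union (h1.image fun q => q * rho)).subset ?_
      rintro p ⟨hp | hp, hpR⟩
      · exact Or.inl ⟨hp, hpR⟩
      · refine Or.inr ⟨p * rho, ⟨hp, ?_⟩, by simp [mul_assoc, rho_mul_rho]⟩
        rwa [Equiv.Perm.mul_apply, hrhoI]
    exact Set.Finite.of_finite_image (f := Subtype.val)
      (h2.subset (by rintro _ ⟨p, hp, rfl⟩; exact ⟨p.2, hp⟩)) Subtype.val_injective.injOn
  · obtain ⟨R, hR⟩ := exists_dist_smul_le Γ
    refine ⟨R, fun z => ?_⟩
    obtain ⟨g, hg, hgR⟩ := hR z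
    exact ⟨MulAction.toPermHom SL(2, ℝ) ℍ g,
      symmGroup_le_reflGroup Γ (Subgroup.mem_sup_left ⟨g, hg, rfl⟩), hgR⟩

/-! ### A point fixed by no orientation reversing element -/

/-- The point `x + i` of the horocycle `im z = 1`. -/
def horoPoint (x : ℝ) : ℍ := ⟨⟨x, 1⟩, one_pos⟩

/-- An orientation reversing isometry fixes at most two points of the horocycle `im z = 1`, as
their real parts are the zeros of a non-zero quadratic polynomial. -/
lemma finite_setOf_smul_rho_eq (g : SL(2, ℝ)) :
    {x : ℝ | g • rho (horoPoint x) = horoPoint x}.Finite := by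
  -- the real part of the fixed point equation at `x + i`, combined with `g 0 0 = g 1 1`
  set P : Polynomial ℝ := Polynomial.C (g 1 0) * Polynomial.X ^ 2
    - Polynomial.C (2 * g 0 0) * Polynomial.X + Polynomial.C (g 0 1 + g 1 0) with hP
  have hdet := SL_det g
  have key : ∀ x : ℝ, g • rho (horoPoint x) = horoPoint x →
      g 0 0 = g 1 1 ∧ g 1 0 * x ^ 2 - 2 * g 0 0 * x + (g 0 1 + g 1 0) = 0 := by
    intro x hx
    have h1 := congrArg UpperHalfPlane.coe hx
    rw [UpperHalfPlane.coe_specialLinearGroup_apply, div_eq_iff (by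
      have := UpperHalfPlane.denom_ne_zero (Matrix.SpecialLinearGroup.mapGL ℝ g) (rho (horoPoint x))
      simpa [UpperHalfPlane.denom, coe_rho] using this)] at h1
    have hre : (horoPoint x).re = x := rfl
    have him : (horoPoint x).im = 1 := rfl
    have h2 := congrArg Complex.re h1
    have h3 := congrArg Complex.im h1
    simp [coe_rho, hre, him] at h2 h3
    constructor
    · linarith
    · have : g 0 0 = g 1 1 := by linarith
      rw [this] at h2 ⊢
      linarith
  by_cases hP0 : P = 0
  · have h1 : g 1 0 = 0 := by
      have := congrArg (fun Q => Polynomial.coeff Q 2) hP0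
      simpa [hP, Polynomial.coeff_X, Polynomial.coeff_C] using this
    have h2 : g 0 0 = 0 := by
      have := congrArg (fun Q => Polynomial.coeff Q 1) hP0
      simpa [hP, Polynomial.coeff_X, Polynomial.coeff_C, Polynomial.coeff_X_pow] using this
    rw [h1, h2] at hdet
    norm_num at hdet
  · refine (P.roots.toFinset.finite_toSet).subset fun x hx => ?_
    simp only [Finset.mem_coe, Multiset.mem_toFinset, Polynomial.mem_roots hP0,
      Polynomial.IsRoot.def]
    have := (key x hx).2
    simpa [hP] using this

lemma rho_notMem_symmGroup (Γ : Subgroup SL(2, ℝ)) : rho ∉ symmGroup Γ := by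
  intro h
  obtain ⟨g, hg⟩ := exists_SL_of_mem_symmGroup h
  have h1 := finite_setOf_smul_rho_eq g
  have h2 : {x : ℝ | g • rho (horoPoint x) = horoPoint x} = univ :=
    eq_univ_of_forall fun x => by
      change g • rho (horoPoint x) = horoPoint x
      rw [← hg, rho_rho]
  rw [h2] at h1
  exact infinite_univ h1

/-- The group is countable and each orientation reversing element fixes only finitely many points
of the horocycle, so some point of the horocycle is fixed by no such element. -/
lemma exists_forall_eq_imp_mem_symmGroup {Γ : Subgroup SL(2, ℝ)}
    (hG : IsCocompactIsometryGroup (reflGroup Γ)) :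
    ∃ z₀ : ℍ, ∀ p : reflGroup Γ, p.1 z₀ = z₀ → p.1 ∈ symmGroup Γ := by
  have hcount : Countable (reflGroup Γ) := by
    rw [← countable_univ_iff]
    have : (univ : Set (reflGroup Γ)) =
        ⋃ n : ℕ, {g | dist (g.1 UpperHalfPlane.I) UpperHalfPlane.I ≤ n} := by
      refine (eq_univ_of_forall fun g => ?_).symm
      obtain ⟨n, hn⟩ := exists_nat_ge (dist (g.1 UpperHalfPlane.I) UpperHalfPlane.I)
      exact mem_iUnion.2 ⟨n, hn⟩
    rw [this]
    exact countable_iUnion fun n => (hG.finite n).countable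
  have hbad : (⋃ p : reflGroup Γ, {x : ℝ | p.1 (horoPoint x) = horoPoint x ∧
      p.1 ∉ symmGroup Γ}).Countable := by
    refine countable_iUnion fun p => Set.Finite.countable ?_
    by_cases hp : p.1 ∈ symmGroup Γ
    · simp [hp]
    · obtain ⟨g, hg⟩ := exists_SL_of_mem_symmGroup (p.2.resolve_left hp)
      refine (finite_setOf_smul_rho_eq g).subset fun x hx => ?_
      change g • rho (horoPoint x) = horoPoint x
      rw [← hg]
      simpa using hx.1
  obtain ⟨x, hx⟩ : ∃ x : ℝ, x ∉ ⋃ p : reflGroup Γ, {x : ℝ | p.1 (horoPoint x) = horoPoint x ∧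
      p.1 ∉ symmGroup Γ} := by
    by_contra! hall
    exact not_countable_univ ((eq_univ_of_forall hall) ▸ hbad)
  refine ⟨horoPoint x, fun p hp => ?_⟩
  by_contra hpn
  exact hx (mem_iUnion.2 ⟨p, hp, hpn⟩)

lemma rho_axis (t : ℝ) : rho (axis t) = axis t := by
  ext
  rw [coe_rho]
  apply Complex.ext <;> simp [axis]

/-- A non-zero function transforming by `reflChar Γ` is odd under the reflection, hence not constant
and zero on the axis. -/
theorem exists_eigenfunction_of_finiteIndex (Γ : Subgroup SL(2, ℝ)) [DiscreteTopology Γ]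
    [CompactSpace (MulAction.orbitRel.Quotient Γ ℍ)]
    (h : ((transf Γ).subgroupOf (symmGroup Γ)).FiniteIndex) :
    ∃ (φ : ℍ → ℝ) (μ : ℝ), IsLaplaceEigenfunction Γ μ φ ∧
      (¬ ∃ c : ℝ, ∀ z : ℍ, φ z = c) ∧ ∀ t : ℝ, φ (axis t) = 0 := by
  have hG := isCocompactIsometryGroup_reflGroup Γ h
  have hε : ∀ p, reflChar Γ p * reflChar Γ p = 1 := fun p => by
    by_cases hp : p.1 ∈ symmGroup Γ
    · rw [reflChar_of_mem hp, one_mul]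
    · rw [reflChar_of_notMem hp]; norm_num
  obtain ⟨z₀, hz₀⟩ := exists_forall_eq_imp_mem_symmGroup hG
  obtain ⟨F, μ, hF1, hF2, hF3, z₁, hz₁⟩ := hG.exists_eigenfunction hε z₀ fun p hp =>
    reflChar_of_mem (hz₀ p hp)
  have hodd : ∀ z, F (rho z) = -F z := fun z => by
    have := hF3 ⟨rho, rho_mem_reflGroup Γ⟩ z
    rwa [reflChar_of_notMem (rho_notMem_symmGroup Γ), neg_one_mul] at this
  refine ⟨F, μ, ⟨fun g hg z => ?_, hF1, hF2⟩, ?_, fun t => ?_⟩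
  · have hmem : MulAction.toPermHom SL(2, ℝ) ℍ g ∈ symmGroup Γ :=
      Subgroup.mem_sup_left ⟨g, hg, rfl⟩
    have := hF3 ⟨_, symmGroup_le_reflGroup Γ hmem⟩ z
    rwa [reflChar_of_mem hmem, one_mul] at this
  · rintro ⟨c, hc⟩
    have := hodd z₁
    rw [hc, hc] at this
    rw [hc] at hz₁
    exact hz₁ (by linarith)
  · have := hodd (axis t)
    rw [rho_axis] at this
    linarith

/-! ### Uniqueness for the reduced ordinary differential equation -/

/-- A solution of `D'' = q D` with zero Cauchy data vanishes; `q` may be unbounded near the ends of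
the interval. -/
lemma eq_zero_of_hasDerivAt_of_hasDerivAt {E : Type*} [NormedAddCommGroup E] [NormedSpace ℝ E]
    {a b t₀ : ℝ} {q : ℝ → ℝ} (hq : ContinuousOn q (Ioo a b)) {D D' : ℝ → E}
    (hD : ∀ t ∈ Ioo a b, HasDerivAt D (D' t) t)
    (hD' : ∀ t ∈ Ioo a b, HasDerivAt D' (q t • D t) t) (ht₀ : t₀ ∈ Ioo a b)
    (h0 : D t₀ = 0) (h0' : D' t₀ = 0) {t : ℝ} (ht : t ∈ Ioo a b) : D t = 0 := by
  -- shrink to an interval on whose closure `q` is bounded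
  obtain ⟨a', ha', ha''⟩ := exists_between (lt_min ht₀.1 ht.1)
  obtain ⟨b', hb', hb''⟩ := exists_between (max_lt ht₀.2 ht.2)
  have hsub : Icc a' b' ⊆ Ioo a b := fun x hx => ⟨ha'.trans_le hx.1, hx.2.trans_lt hb''⟩
  obtain ⟨M, hM⟩ := isCompact_Icc.exists_bound_of_continuousOn (hq.mono hsub)
  have hlip : ∀ x ∈ Ioo a' b', LipschitzOnWith (max 1 M.toNNReal)
      (fun p : E × E => (p.2, q x • p.1)) univ := by
    intro x hx
    have h1 : LipschitzWith 1 fun p : E × E => p.2 := LipschitzWith.prod_snd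
    have h2 : LipschitzWith M.toNNReal fun p : E × E => q x • p.1 := by
      have h3 : ‖q x‖₊ * 1 ≤ M.toNNReal := by
        rw [mul_one]
        exact NNReal.le_toNNReal_of_coe_le (hM x (Ioo_subset_Icc_self hx))
      exact ((lipschitzWith_smul (q x)).comp LipschitzWith.prod_fst).weaken h3
    exact (h1.prodMk h2).lipschitzOnWith
  have hderiv : ∀ x ∈ Ioo a b, HasDerivAt (fun x => (D x, D' x)) (D' x, q x • D x) x :=
    fun x hx => (hD x hx).prodMk (hD' x hx)
  have h := ODE_solution_unique_of_mem_Ioo (v := fun x (p : E × E) => (p.2, q x • p.1))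
    (f := fun x => (D x, D' x)) (g := fun _ => 0) (s := fun _ => univ) hlip
    (t₀ := t₀) ⟨ha''.trans_le (min_le_left _ _), (le_max_left _ _).trans_lt hb'⟩
    (fun x hx => ⟨hderiv x (hsub (Ioo_subset_Icc_self hx)), mem_univ _⟩)
    (fun x hx => ⟨by
      simpa [← Prod.zero_eq_mk] using hasDerivAt_const x (0 : E × E), mem_univ _⟩)
    (by simp [h0, h0'])
  have := h (x := t) ⟨ha''.trans_le (min_le_right _ _), (le_max_right _ _).trans_lt hb'⟩
  exact congrArg Prod.fst this

/-! ### Fourier coefficients along equidistant curves -/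

/-- The open strip of complex numbers whose imaginary part lies between `a` and `b`. -/
def strip (a b : ℝ) : Set ℂ := {w | w.im ∈ Ioo a b}

lemma isOpen_strip (a b : ℝ) : IsOpen (strip a b) := isOpen_Ioo.preimage Complex.continuous_im

lemma mem_strip {a b s θ : ℝ} (hθ : θ ∈ Ioo a b) : (s + θ * Complex.I : ℂ) ∈ strip a b := by
  simpa [strip] using hθ

lemma continuous_horizontal_comp {E : Type*} [TopologicalSpace E] {a b θ : ℝ} {h : ℂ → E}
    (hh : ContinuousOn h (strip a b)) (hθ : θ ∈ Ioo a b) :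
    Continuous fun s : ℝ => h (s + θ * Complex.I) :=
  hh.comp_continuous (by fun_prop) fun _ => mem_strip hθ

lemma hasDerivAt_vertical (s θ : ℝ) :
    HasDerivAt (fun θ : ℝ => (s + θ * Complex.I : ℂ)) Complex.I θ := by
  simpa using ((Complex.ofRealCLM.hasDerivAt (x := θ)).mul_const Complex.I).const_add (s : ℂ)

lemma hasDerivAt_horizontal (s θ : ℝ) :
    HasDerivAt (fun s : ℝ => (s + θ * Complex.I : ℂ)) 1 s := by
  simpa using (Complex.ofRealCLM.hasDerivAt (x := s)).add_const (θ * Complex.I)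

/-- Differentiation of an integral over a horizontal segment with respect to its height. -/
lemma hasDerivAt_integral_strip {a b θ : ℝ} {h : ℂ → ℝ} (hh : ContDiffOn ℝ 1 h (strip a b))
    {e : ℝ → ℂ} (he : Continuous e) (hθ : θ ∈ Ioo a b) (L : ℝ) :
    HasDerivAt (fun θ : ℝ => ∫ s in (0 : ℝ)..L, h (s + θ * Complex.I) • e s)
      (∫ s in (0 : ℝ)..L, fderiv ℝ h (s + θ * Complex.I) Complex.I • e s) θ := by
  have hD : ContinuousOn (fun w => fderiv ℝ h w Complex.I) (strip a b) :=
    (hh.continuousOn_fderiv_of_isOpen (isOpen_strip a b) le_rfl).clm_apply continuousOn_const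
  obtain ⟨r, hr, hsub⟩ := Metric.nhds_basis_closedBall.mem_iff.1 (isOpen_Ioo.mem_nhds hθ)
  have hK : IsCompact (uIcc 0 L ×ˢ Metric.closedBall θ r) :=
    isCompact_uIcc.prod (isCompact_closedBall θ r)
  have hcont : ContinuousOn (fun p : ℝ × ℝ => fderiv ℝ h (p.1 + p.2 * Complex.I) Complex.I • e p.1)
      (uIcc 0 L ×ˢ Metric.closedBall θ r) := by
    refine (hD.comp (f := fun p : ℝ × ℝ => (p.1 + p.2 * Complex.I : ℂ)) (by fun_prop)
      fun p hp => mem_strip (hsub hp.2)).smul (by fun_prop)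
  obtain ⟨M, hM⟩ := hK.exists_bound_of_continuousOn hcont
  refine (intervalIntegral.hasDerivAt_integral_of_dominated_loc_of_deriv_le
    (𝕜 := ℝ) (x₀ := θ) (s := Metric.closedBall θ r)
    (F' := fun (θ s : ℝ) => fderiv ℝ h (s + θ * Complex.I) Complex.I • e s) (bound := fun _ => M)
    (Metric.closedBall_mem_nhds θ hr) ?_ ?_ ?_ ?_ intervalIntegrable_const ?_).2
  · filter_upwards [isOpen_Ioo.mem_nhds hθ] with x hx
    exact ((continuous_horizontal_comp hh.continuousOn hx).smul he).aestronglyMeasurable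
  · exact ((continuous_horizontal_comp hh.continuousOn hθ).smul he).intervalIntegrable _ _
  · exact ((continuous_horizontal_comp hD hθ).smul he).aestronglyMeasurable
  · exact ae_of_all _ fun s hs x hx => hM (s, x) ⟨uIoc_subset_uIcc hs, hx⟩
  · refine ae_of_all _ fun s _ x hx => HasDerivAt.smul_const ?_ (e s)
    have h1 := ((hh.contDiffAt ((isOpen_strip a b).mem_nhds (mem_strip (s := s)
      (hsub hx)))).differentiableAt (by simp)).hasFDerivAt
    exact h1.comp_hasDerivAt x (hasDerivAt_vertical s x)

/-- Two integrations by parts over a period, whose boundary terms cancel. -/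
lemma integral_fderiv_fderiv_smul_of_periodic {a b θ L : ℝ} {u : ℂ → ℝ}
    (hu : ContDiffOn ℝ 2 u (strip a b)) (hper : ∀ w ∈ strip a b, u (w + L) = u w)
    (hθ : θ ∈ Ioo a b) {e e' e'' : ℝ → ℂ} (he : ∀ s, HasDerivAt e (e' s) s)
    (he' : ∀ s, HasDerivAt e' (e'' s) s) (he'' : Continuous e'') (hL : e L = e 0)
    (hL' : e' L = e' 0) :
    ∫ s in (0 : ℝ)..L, fderiv ℝ (fderiv ℝ u) (s + θ * Complex.I) 1 1 • e s =
      ∫ s in (0 : ℝ)..L, u (s + θ * Complex.I) • e'' s := by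
  have hu1 : ContDiffOn ℝ 1 (fderiv ℝ u) (strip a b) :=
    hu.fderiv_of_isOpen (isOpen_strip a b) (by norm_num)
  have hu2 : ContinuousOn (fun w => fderiv ℝ (fderiv ℝ u) w 1 1) (strip a b) :=
    ((hu1.continuousOn_fderiv_of_isOpen (isOpen_strip a b) le_rfl).clm_apply
      continuousOn_const).clm_apply continuousOn_const
  have hec : Continuous e := continuous_iff_continuousAt.2 fun s => (he s).continuousAt
  have hd1 : ∀ s : ℝ, HasDerivAt (fun s : ℝ => u (s + θ * Complex.I))
      (fderiv ℝ u (s + θ * Complex.I) 1) s := fun s =>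
    ((hu.contDiffAt ((isOpen_strip a b).mem_nhds (mem_strip hθ))).differentiableAt
      (by simp)).hasFDerivAt.comp_hasDerivAt s (hasDerivAt_horizontal s θ)
  have hd2 : ∀ s : ℝ, HasDerivAt (fun s : ℝ => fderiv ℝ u (s + θ * Complex.I) 1)
      (fderiv ℝ (fderiv ℝ u) (s + θ * Complex.I) 1 1) s := fun s => by
    have := ((hu1.contDiffAt ((isOpen_strip a b).mem_nhds (mem_strip (s := s) hθ))).differentiableAt
      (by simp)).hasFDerivAt.comp_hasDerivAt s (hasDerivAt_horizontal s θ)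
    simpa using this.clm_apply (hasDerivAt_const s (1 : ℂ))
  have hperD : fderiv ℝ u (0 + θ * Complex.I + L) = fderiv ℝ u (0 + θ * Complex.I) := by
    rw [← fderiv_comp_add_right]
    refine Filter.EventuallyEq.fderiv_eq ?_
    filter_upwards [(isOpen_strip a b).mem_nhds (by simpa using mem_strip (s := 0) hθ)] with w hw
    exact hper w hw
  have hperu : u (0 + θ * Complex.I + L) = u (0 + θ * Complex.I) :=
    hper _ (by simpa using mem_strip (s := 0) hθ)
  have hderiv : ∀ s : ℝ, HasDerivAt (fun s : ℝ => fderiv ℝ u (s + θ * Complex.I) 1 • e s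
      - u (s + θ * Complex.I) • e' s)
      (fderiv ℝ (fderiv ℝ u) (s + θ * Complex.I) 1 1 • e s - u (s + θ * Complex.I) • e'' s) s := by
    intro s
    refine (((hd2 s).smul (he s)).sub ((hd1 s).smul (he' s))).congr_deriv ?_
    abel
  have hi1 : Continuous fun s : ℝ => fderiv ℝ (fderiv ℝ u) (s + θ * Complex.I) 1 1 • e s :=
    (continuous_horizontal_comp hu2 hθ).smul hec
  have hi2 : Continuous fun s : ℝ => u (s + θ * Complex.I) • e'' s :=
    (continuous_horizontal_comp hu.continuousOn hθ).smul he''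
  rw [← sub_eq_zero, ← intervalIntegral.integral_sub (hi1.intervalIntegrable _ _)
    (hi2.intervalIntegrable _ _), intervalIntegral.integral_eq_sub_of_hasDerivAt
    (fun s _ => hderiv s) ((hi1.sub hi2).intervalIntegrable _ _)]
  have h0 : ((L : ℝ) + θ * Complex.I : ℂ) = 0 + θ * Complex.I + L := by ring
  rw [h0, hperD, hperu, hL, hL']
  simp

/-- A continuous periodic function all of whose Fourier coefficients vanish is zero. -/
lemma eq_zero_of_integral_fourier_eq_zero {L : ℝ} (hL : 0 < L) {g : ℝ → ℝ} (hg : Continuous g)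
    (hper : ∀ s, g (s + L) = g s)
    (h : ∀ n : ℤ, ∫ s in (0 : ℝ)..L, g s • fourier (T := L) n (s : AddCircle L) = 0) (s : ℝ) :
    g s = 0 := by
  have : Fact (0 < L) := ⟨hL⟩
  have hp : Function.Periodic (fun s => (g s : ℂ)) L := fun s => by simp only [hper]
  let G : C(AddCircle L, ℂ) := ⟨hp.lift, continuous_coinduced_dom.2 (by
    exact (Complex.continuous_ofReal.comp hg))⟩
  have hcoe : ∀ s : ℝ, G (s : AddCircle L) = g s := fun s => hp.lift_coe s
  have hcoef : fourierCoeff G = 0 := by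
    funext n
    rw [fourierCoeff_eq_intervalIntegral _ n 0, zero_add]
    have : ∀ s : ℝ, fourier (-n) (s : AddCircle L) • G (s : AddCircle L) =
        g s • fourier (T := L) (-n) (s : AddCircle L) := fun s => by
      rw [hcoe, smul_eq_mul, Complex.real_smul, mul_comm]
    simp only [this, h, smul_zero, Pi.zero_apply]
  have hsum := has_pointwise_sum_fourier_series_of_summable (f := G)
    (by rw [hcoef]; exact summable_zero) (s : AddCircle L)
  rw [hcoef] at hsum
  simp only [Pi.zero_apply, zero_smul] at hsum
  have := hsum.unique hasSum_zero
  rw [hcoe] at this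
  exact_mod_cast this

/-! ### Eigenfunctions vanishing on the axis are odd -/

/-- The Laplacian in the conformal coordinate `w = log z`. -/
lemma fderiv_fderiv_comp_exp {f : ℂ → ℝ} {w : ℂ} (hf : ContDiffAt ℝ 2 f (Complex.exp w)) :
    fderiv ℝ (fderiv ℝ fun w => f (Complex.exp w)) w 1 1
      + fderiv ℝ (fderiv ℝ fun w => f (Complex.exp w)) w Complex.I Complex.I
      = ‖Complex.exp w‖ ^ 2 * Laplacian.laplacian f (Complex.exp w) := by
  have hexp : ContDiff ℝ 2 Complex.exp := Complex.contDiff_exp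
  have hu : ContDiffAt ℝ 2 (fun w => f (Complex.exp w)) w := hf.comp w hexp.contDiffAt
  have hline : ∀ (v : ℂ) (t : ℝ), HasDerivAt (fun t : ℝ => Complex.exp (w + t • v))
      (Complex.exp (w + t • v) * v) t := fun v t => by
    have h1 : HasDerivAt (fun t : ℝ => w + t • v) v t := by
      simpa using ((hasDerivAt_id t).smul_const v).const_add w
    exact (Complex.hasDerivAt_exp _).scomp t h1 |>.congr_deriv (by simp [mul_comm])
  have hc : ∀ v : ℂ, Tendsto (fun t : ℝ => Complex.exp (w + t • v)) (𝓝 0) (𝓝 (Complex.exp w)) :=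
    fun v => by simpa using (hline v 0).continuousAt.tendsto
  have h2 : ∀ v : ℂ, fderiv ℝ (fderiv ℝ fun w => f (Complex.exp w)) w v v =
      fderiv ℝ (fderiv ℝ f) (Complex.exp w) (Complex.exp w * v) (Complex.exp w * v)
        + fderiv ℝ f (Complex.exp w) (Complex.exp w * v * v) := by
    intro v
    refine fderiv_fderiv_apply_self
      (d := fun t => fderiv ℝ f (Complex.exp (w + t • v)) (Complex.exp (w + t • v) * v)) hu ?_ ?_
    · filter_upwards [(hc v).eventually (hf.eventually (by simp))] with t ht
      exact (ht.differentiableAt (by simp)).hasFDerivAt.comp_hasDerivAt t (hline v t)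
    · have h3 : HasFDerivAt (fderiv ℝ f) (fderiv ℝ (fderiv ℝ f) (Complex.exp w))
          (Complex.exp (w + (0 : ℝ) • v)) := by
        rw [zero_smul, add_zero]
        exact ((hf.fderiv_right (m := 1) (by norm_num)).differentiableAt (by simp)).hasFDerivAt
      have h4 := h3.comp_hasDerivAt (0 : ℝ) (hline v 0)
      have := h4.clm_apply ((hline v 0).mul_const v)
      simpa using this
  rw [h2, h2, laplacian_eq_fderiv_fderiv]
  set ζ := Complex.exp w with hζ
  have e1 : ζ * 1 = ζ.re • (1 : ℂ) + ζ.im • Complex.I := by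
    apply Complex.ext <;> simp
  have e2 : ζ * Complex.I = (-ζ.im) • (1 : ℂ) + ζ.re • Complex.I := by
    apply Complex.ext <;> simp
  have e3 : fderiv ℝ f ζ (ζ * Complex.I * Complex.I) = - fderiv ℝ f ζ (ζ * 1 * 1) := by
    rw [mul_assoc, Complex.I_mul_I, mul_neg, map_neg, mul_one, mul_one]
  rw [e3, e1, e2, Complex.sq_norm, Complex.normSq_apply]
  simp only [map_add, map_smul, add_apply, smul_apply,
    smul_eq_mul]
  ring

lemma coe_axis (t : ℝ) : (axis t : ℂ) = Real.exp t * Complex.I := by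
  apply Complex.ext <;> simp [axis, -Complex.ofReal_exp]

lemma smul_mul_denom (g : SL(2, ℝ)) (z : ℍ) :
    ((g • z : ℍ) : ℂ) * (g 1 0 * z + g 1 1) = g 0 0 * z + g 0 1 := by
  have h : (g 1 0 : ℂ) * z + g 1 1 ≠ 0 := by
    have := UpperHalfPlane.denom_ne_zero (Matrix.SpecialLinearGroup.mapGL ℝ g) z
    simpa [UpperHalfPlane.denom] using this
  rw [UpperHalfPlane.coe_specialLinearGroup_apply]
  simp only [Algebra.algebraMap_self, RingHom.id_apply]
  exact div_mul_cancel₀ _ h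

/-- A matrix which translates the imaginary axis along itself is diagonal. -/
lemma entries_of_smul_axis {g : SL(2, ℝ)} {L : ℝ} (h : ∀ t, g • axis t = axis (t + L)) :
    g 0 1 = 0 ∧ g 1 0 = 0 ∧ g 0 0 = Real.exp L * g 1 1 := by
  have h1 : ∀ t, Real.exp L * Real.exp t ^ 2 * g 1 0 = - g 0 1 ∧
      g 0 0 = Real.exp L * g 1 1 := fun t => by
    have := smul_mul_denom g (axis t)
    rw [h, coe_axis, coe_axis, Real.exp_add] at this
    have hre := congrArg Complex.re this
    have him := congrArg Complex.im this
    simp [-Complex.ofReal_exp] at hre him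
    have ht := Real.exp_pos t
    constructor
    · linarith
    · have : Real.exp t * (g 0 0) = Real.exp t * (Real.exp L * g 1 1) := by linarith
      exact mul_left_cancel₀ ht.ne' this
  have h2 := (h1 0).1
  have h3 := (h1 1).1
  rw [Real.exp_zero] at h2
  have h4 : 1 < Real.exp 1 := by simp
  have h5 : Real.exp L * (Real.exp 1 ^ 2 - 1) * g 1 0 = 0 := by linarith
  have h6 : Real.exp L * (Real.exp 1 ^ 2 - 1) ≠ 0 := by
    have := Real.exp_pos L
    have : 0 < Real.exp 1 ^ 2 - 1 := by nlinarith
    positivity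
  have h7 : g 1 0 = 0 := (mul_eq_zero.1 h5).resolve_left h6
  rw [h7] at h2
  exact ⟨by linarith, h7, (h1 0).2⟩

lemma coe_smul_of_smul_axis {g : SL(2, ℝ)} {L : ℝ} (h : ∀ t, g • axis t = axis (t + L)) (z : ℍ) :
    ((g • z : ℍ) : ℂ) = Real.exp L * z := by
  obtain ⟨h1, h2, h3⟩ := entries_of_smul_axis h
  have h4 := smul_mul_denom g z
  have hdet := SL_det g
  have h5 : g 1 1 ≠ 0 := by
    intro h5
    rw [h5, h1] at hdet
    norm_num at hdet
  have h5' : (g 1 1 : ℂ) ≠ 0 := by exact_mod_cast h5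
  rw [h1, h2, h3] at h4
  apply mul_right_cancel₀ h5'
  push_cast [-Complex.ofReal_exp] at h4
  linear_combination h4

lemma contDiffOn_comp_exp {f : ℂ → ℝ} (hf : ContDiffOn ℝ 2 f {z | 0 < z.im}) :
    ContDiffOn ℝ 2 (fun w => f (Complex.exp w)) (strip 0 Real.pi) := by
  have hexp : ContDiff ℝ 2 Complex.exp := Complex.contDiff_exp
  refine hf.comp hexp.contDiffOn fun w hw => ?_
  change 0 < (Complex.exp w).im
  rw [Complex.exp_im]
  exact mul_pos (Real.exp_pos _) (Real.sin_pos_of_mem_Ioo hw)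

/-- With `u(s, θ) = φ(exp(s + iθ))`, the functions `u(s, θ)` and `-u(s, π - θ)` satisfy the same
equation and have the same Cauchy data on the line `θ = π / 2`; their Fourier coefficients in `s`
are compared by uniqueness for ordinary differential equations. -/
theorem IsLaplaceEigenfunction.comp_rho_eq_neg {Γ : Subgroup SL(2, ℝ)} {μ : ℝ} {φ : ℍ → ℝ}
    (hφ : IsLaplaceEigenfunction Γ μ φ) (hγ : AxisIsClosed Γ) (h0 : ∀ t, φ (axis t) = 0) (z : ℍ) :
    φ (rho z) = -φ z := by
  obtain ⟨g, hg, L, hL, hgL⟩ := hγ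
  set f : ℂ → ℝ := φ ∘ UpperHalfPlane.ofComplex with hf
  have hf' : ∀ z : ℍ, f z = φ z := fun z => by simp [hf]
  set u : ℂ → ℝ := fun w => f (Complex.exp w) with hu
  have hexp_im : ∀ w ∈ strip 0 Real.pi, 0 < (Complex.exp w).im := fun w hw => by
    rw [Complex.exp_im]
    exact mul_pos (Real.exp_pos _) (Real.sin_pos_of_mem_Ioo hw)
  have huC : ContDiffOn ℝ 2 u (strip 0 Real.pi) := contDiffOn_comp_exp hφ.contDiffOn
  have hper : ∀ w ∈ strip 0 Real.pi, u (w + L) = u w := fun w hw => by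
    have h1 : Complex.exp (w + L) = (g • (⟨Complex.exp w, hexp_im w hw⟩ : ℍ) : ℍ) := by
      rw [coe_smul_of_smul_axis hgL, Complex.exp_add, Complex.ofReal_exp, mul_comm]
    have h2 : Complex.exp w = (⟨Complex.exp w, hexp_im w hw⟩ : ℍ) := rfl
    simp only [hu]
    rw [h1, hf', hφ.invariant g hg]
    conv_rhs => rw [h2, hf']
  have hpde : ∀ w ∈ strip 0 Real.pi, fderiv ℝ (fderiv ℝ u) w 1 1 +
      fderiv ℝ (fderiv ℝ u) w Complex.I Complex.I = μ / Real.sin w.im ^ 2 * u w := fun w hw => by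
    have h1 := fderiv_fderiv_comp_exp (hφ.contDiffOn.contDiffAt
      (isOpen_im_pos.mem_nhds (hexp_im w hw)))
    have h2 := hφ.eigen ⟨Complex.exp w, hexp_im w hw⟩
    have h3 : φ ⟨Complex.exp w, hexp_im w hw⟩ = u w := (hf' _).symm
    have hsin : Real.sin w.im ≠ 0 := (Real.sin_pos_of_mem_Ioo hw).ne'
    rw [h3, hypLaplacian] at h2
    change (Complex.exp w).im ^ 2 * Laplacian.laplacian f (Complex.exp w) = _ at h2
    refine h1.trans ?_
    change ‖Complex.exp w‖ ^ 2 * Laplacian.laplacian f (Complex.exp w) = _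
    rw [Complex.exp_im] at h2
    rw [Complex.norm_exp, div_mul_eq_mul_div, ← h2]
    field_simp
  have hmid : Real.pi / 2 ∈ Ioo 0 Real.pi := ⟨by positivity, by linarith [Real.pi_pos]⟩
  have hu0 : ∀ s : ℝ, u (s + (Real.pi / 2 : ℝ) * Complex.I) = 0 := fun s => by
    have : Complex.exp (s + (Real.pi / 2 : ℝ) * Complex.I) = axis s := by
      rw [Complex.exp_add, coe_axis]
      push_cast
      rw [Complex.exp_pi_div_two_mul_I]
    simp only [hu]
    rw [this, hf', h0]
  -- the Fourier coefficients of `u(s, θ) + u(s, π - θ)` vanish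
  have hcoef : ∀ (n : ℤ), ∀ θ ∈ Ioo 0 Real.pi,
      (∫ s in (0 : ℝ)..L, u (s + θ * Complex.I) • fourier (T := L) n (s : AddCircle L)) +
      (∫ s in (0 : ℝ)..L, u (s + (Real.pi - θ : ℝ) * Complex.I) •
        fourier (T := L) n (s : AddCircle L)) = 0 := by
    intro n θ hθ
    set c : ℂ := 2 * Real.pi * Complex.I * n / L with hc
    set e : ℝ → ℂ := fun s => fourier (T := L) n (s : AddCircle L) with he
    have hde : ∀ s, HasDerivAt e (c * e s) s := fun s => hasDerivAt_fourier L n s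
    have hde' : ∀ s, HasDerivAt (fun s => c * e s) (c * (c * e s)) s := fun s =>
      (hde s).const_mul c
    have hec : Continuous e := continuous_iff_continuousAt.2 fun s => (hde s).continuousAt
    have heL : e L = e 0 := by
      simp only [he, AddCircle.coe_period, QuotientAddGroup.mk_zero]
    have hc2 : c * c = -((2 * Real.pi * n / L) ^ 2 : ℝ) := by
      rw [hc]
      push_cast
      linear_combination (2 * Real.pi * n / L : ℂ) ^ 2 * Complex.I_mul_I
    -- the coefficient `d` of `u(·, θ)` satisfies `d'' = q d`
    set q : ℝ → ℝ := fun θ => μ / Real.sin θ ^ 2 + (2 * Real.pi * n / L) ^ 2 with hq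
    have hqc : ContinuousOn q (Ioo 0 Real.pi) := by
      refine (continuousOn_const.div (by fun_prop) fun x hx => ?_).add continuousOn_const
      exact pow_ne_zero _ (Real.sin_pos_of_mem_Ioo hx).ne'
    set d : ℝ → ℂ := fun θ => ∫ s in (0 : ℝ)..L, u (s + θ * Complex.I) • e s with hd
    set d' : ℝ → ℂ := fun θ => ∫ s in (0 : ℝ)..L,
      fderiv ℝ u (s + θ * Complex.I) Complex.I • e s with hd'
    have hu1 : ContDiffOn ℝ 1 (fderiv ℝ u) (strip 0 Real.pi) :=
      huC.fderiv_of_isOpen (isOpen_strip _ _) (by norm_num)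
    have hu1I : ContDiffOn ℝ 1 (fun w => fderiv ℝ u w Complex.I) (strip 0 Real.pi) :=
      hu1.clm_apply contDiffOn_const
    have hu2 : ContinuousOn (fun w => fderiv ℝ (fderiv ℝ u) w 1 1) (strip 0 Real.pi) :=
      ((hu1.continuousOn_fderiv_of_isOpen (isOpen_strip _ _) le_rfl).clm_apply
        continuousOn_const).clm_apply continuousOn_const
    have hdd : ∀ t ∈ Ioo 0 Real.pi, HasDerivAt d (d' t) t := fun t ht =>
      hasDerivAt_integral_strip (huC.of_le (by norm_num)) hec ht L
    have hdd' : ∀ t ∈ Ioo 0 Real.pi, HasDerivAt d' (q t • d t) t := fun t ht => by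
      refine (hasDerivAt_integral_strip hu1I hec ht L).congr_deriv ?_
      have h1 : ∀ s : ℝ, fderiv ℝ (fun w => fderiv ℝ u w Complex.I) (s + t * Complex.I) Complex.I
          = μ / Real.sin t ^ 2 * u (s + t * Complex.I)
            - fderiv ℝ (fderiv ℝ u) (s + t * Complex.I) 1 1 := fun s => by
        have h2 := hpde _ (mem_strip (s := s) ht)
        have h3 : (s + t * Complex.I : ℂ).im = t := by simp
        rw [h3] at h2
        rw [← h2, fderiv_clm_apply ((hu1.contDiffAt ((isOpen_strip _ _).mem_nhds
          (mem_strip ht))).differentiableAt (by simp)) (by fun_prop)]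
        simp
      have hi1 : Continuous fun s : ℝ => u (s + t * Complex.I) • e s :=
        (continuous_horizontal_comp huC.continuousOn ht).smul hec
      have hi2 : Continuous fun s : ℝ => fderiv ℝ (fderiv ℝ u) (s + t * Complex.I) 1 1 • e s :=
        (continuous_horizontal_comp hu2 ht).smul hec
      have hi3 : Continuous fun s : ℝ => (μ / Real.sin t ^ 2) • u (s + t * Complex.I) • e s :=
        hi1.const_smul (μ / Real.sin t ^ 2)
      simp only [h1, sub_smul, mul_smul]
      rw [intervalIntegral.integral_sub (hi3.intervalIntegrable _ _)
        (hi2.intervalIntegrable _ _), intervalIntegral.integral_smul,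
        integral_fderiv_fderiv_smul_of_periodic huC hper ht hde hde' (by fun_prop) heL
        (by rw [heL])]
      have h4 : ∀ s : ℝ, u (s + t * Complex.I) • (c * (c * e s)) =
          (-(2 * Real.pi * n / L) ^ 2) • (u (s + t * Complex.I) • e s) := fun s => by
        rw [← mul_assoc, hc2]
        simp only [Complex.real_smul]
        push_cast
        ring
      simp only [h4]
      rw [intervalIntegral.integral_smul, neg_smul, sub_neg_eq_add, ← add_smul]
    have hsymm : ∀ t ∈ Ioo 0 Real.pi, Real.pi - t ∈ Ioo 0 Real.pi := fun t ht =>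
      ⟨by linarith [ht.2], by linarith [ht.1]⟩
    have hmid' : Real.pi - Real.pi / 2 = Real.pi / 2 := by ring
    have hd0 : d (Real.pi / 2) = 0 := by
      simp only [hd, hu0, zero_smul, intervalIntegral.integral_zero]
    refine eq_zero_of_hasDerivAt_of_hasDerivAt hqc (D := fun t => d t + d (Real.pi - t))
      (D' := fun t => d' t - d' (Real.pi - t)) (fun t ht => ?_) (fun t ht => ?_) hmid
      (by simp only [hmid', hd0, add_zero]) (by simp only [hmid', sub_self]) hθ
    · have := (hdd t ht).add ((hdd _ (hsymm t ht)).comp_const_sub Real.pi t)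
      exact this.congr_deriv (by abel)
    · have := (hdd' t ht).sub ((hdd' _ (hsymm t ht)).comp_const_sub Real.pi t)
      refine this.congr_deriv ?_
      have h5 : q (Real.pi - t) = q t := by simp [hq]
      rw [h5, smul_add]
      abel
  have hodd : ∀ θ ∈ Ioo 0 Real.pi, ∀ s : ℝ,
      u (s + θ * Complex.I) + u (s + (Real.pi - θ : ℝ) * Complex.I) = 0 := by
    intro θ hθ s
    have hθ' : Real.pi - θ ∈ Ioo 0 Real.pi := ⟨by linarith [hθ.2], by linarith [hθ.1]⟩
    have hshift : ∀ x s : ℝ, ((s + L : ℝ) + x * Complex.I : ℂ) = s + x * Complex.I + L :=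
      fun x s => by push_cast; ring
    have hc1 := continuous_horizontal_comp huC.continuousOn hθ
    have hc2 := continuous_horizontal_comp huC.continuousOn hθ'
    refine eq_zero_of_integral_fourier_eq_zero hL
      (g := fun s => u (s + θ * Complex.I) + u (s + (Real.pi - θ : ℝ) * Complex.I))
      (hc1.add hc2) (fun s => ?_) (fun n => ?_) s
    · simp only [hshift]
      rw [hper _ (mem_strip hθ), hper _ (mem_strip hθ')]
    · have hfc : Continuous fun s : ℝ => fourier (T := L) n (s : AddCircle L) :=
        (fourier n).continuous.comp (AddCircle.continuous_mk' L)
      have hi1 : Continuous fun s : ℝ =>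
        u (s + θ * Complex.I) • fourier (T := L) n (s : AddCircle L) := hc1.smul hfc
      have hi2 : Continuous fun s : ℝ => u (s + (Real.pi - θ : ℝ) * Complex.I) •
        fourier (T := L) n (s : AddCircle L) := hc2.smul hfc
      simp only [add_smul]
      rw [intervalIntegral.integral_add (hi1.intervalIntegrable _ _)
        (hi2.intervalIntegrable _ _)]
      exact hcoef n θ hθ
  -- write `z` in logarithmic coordinates
  have hz0 : (z : ℂ) ≠ 0 := UpperHalfPlane.ne_zero z
  have hz := Complex.exp_log hz0
  set w := Complex.log z with hw
  have him : w.im ∈ Ioo 0 Real.pi := by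
    rw [hw, Complex.log_im]
    have h1 : (z : ℂ).im ≠ 0 := z.im_ne_zero
    refine ⟨lt_of_le_of_ne (Complex.arg_nonneg_iff.2 z.im_pos.le) fun h => ?_,
      lt_of_le_of_ne (Complex.arg_le_pi _) fun h => ?_⟩
    · exact h1 (Complex.arg_eq_zero_iff.1 h.symm).2
    · exact h1 (Complex.arg_eq_pi_iff.1 h).2
  have h1 := hodd w.im him w.re
  have h2 : Complex.exp (w.re + (Real.pi - w.im : ℝ) * Complex.I) = rho z := by
    have : (w.re + (Real.pi - w.im : ℝ) * Complex.I : ℂ)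
        = (starRingEnd ℂ) w + Real.pi * Complex.I := by
      apply Complex.ext
      · simp
      · simp; ring
    rw [this, Complex.exp_add, Complex.exp_pi_mul_I, Complex.exp_conj, hz, coe_rho]
    ring
  simp only [hu] at h1
  rw [h2, Complex.re_add_im, hz, hf', hf'] at h1
  linarith

/-! ### Closed subgroups of `SL(2, ℝ)` containing a translation along the axis -/

lemma SL_mul_apply (g h : SL(2, ℝ)) (i j : Fin 2) :
    (g * h) i j = g i 0 * h 0 j + g i 1 * h 1 j := by
  rw [Matrix.SpecialLinearGroup.coe_mul, Matrix.mul_apply, Fin.sum_univ_two]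

lemma SL_inv_apply (g : SL(2, ℝ)) :
    g⁻¹ 0 0 = g 1 1 ∧ g⁻¹ 0 1 = -g 0 1 ∧ g⁻¹ 1 0 = -g 1 0 ∧ g⁻¹ 1 1 = g 0 0 := by
  rw [Matrix.SpecialLinearGroup.coe_inv, Matrix.adjugate_fin_two]
  simp

lemma continuous_SL_apply (i j : Fin 2) : Continuous fun g : SL(2, ℝ) => g i j :=
  (continuous_apply_apply i j).comp continuous_subtype_val

lemma tendsto_SL_iff {ι : Type*} {l : Filter ι} {f : ι → SL(2, ℝ)} {g : SL(2, ℝ)} :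
    Tendsto f l (𝓝 g) ↔ ∀ i j, Tendsto (fun x => f x i j) l (𝓝 (g i j)) := by
  have h := tendsto_subtype_rng (p := fun A : Matrix (Fin 2) (Fin 2) ℝ => A.det = 1) (f := f)
    (l := l) (x := g)
  exact h.trans (tendsto_pi_nhds.trans (forall_congr' fun i => tendsto_pi_nhds))

lemma firstCountableTopology_SL : FirstCountableTopology SL(2, ℝ) := by
  have : FirstCountableTopology (Matrix (Fin 2) (Fin 2) ℝ) :=
    inferInstanceAs (FirstCountableTopology (Fin 2 → Fin 2 → ℝ))
  exact (Topology.IsInducing.subtypeVal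
    (t := {A : Matrix (Fin 2) (Fin 2) ℝ | A.det = 1})).firstCountableTopology

/-- The unipotent matrix acting on the upper half plane as the translation `z ↦ z + t`. -/
def upperUnipotent (t : ℝ) : SL(2, ℝ) := ⟨!![1, t; 0, 1], by simp⟩

lemma upperUnipotent_apply (t : ℝ) : upperUnipotent t 0 0 = 1 ∧ upperUnipotent t 0 1 = t ∧
    upperUnipotent t 1 0 = 0 ∧ upperUnipotent t 1 1 = 1 := by
  simp [upperUnipotent]

lemma SL_ext {g h : SL(2, ℝ)} (h1 : g 0 0 = h 0 0) (h2 : g 0 1 = h 0 1) (h3 : g 1 0 = h 1 0)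
    (h4 : g 1 1 = h 1 1) : g = h := by
  ext i j
  fin_cases i <;> fin_cases j <;> assumption

lemma upperUnipotent_add (s t : ℝ) :
    upperUnipotent (s + t) = upperUnipotent s * upperUnipotent t := by
  obtain ⟨a1, a2, a3, a4⟩ := upperUnipotent_apply s
  obtain ⟨b1, b2, b3, b4⟩ := upperUnipotent_apply t
  obtain ⟨c1, c2, c3, c4⟩ := upperUnipotent_apply (s + t)
  apply SL_ext <;> rw [SL_mul_apply] <;> simp only [*] <;> ring

lemma upperUnipotent_zero : upperUnipotent 0 = 1 := by
  obtain ⟨a1, a2, a3, a4⟩ := upperUnipotent_apply 0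
  apply SL_ext <;> simp [*]

lemma continuous_upperUnipotent : Continuous upperUnipotent := by
  refine Continuous.subtype_mk (continuous_pi fun i => continuous_pi fun j => ?_) _
  fin_cases i <;> fin_cases j <;> simp <;> fun_prop

/-- The parameters of the upper unipotent elements of a group of matrices. -/
def unipotentParams (S : Subgroup SL(2, ℝ)) : AddSubgroup ℝ where
  carrier := {t | upperUnipotent t ∈ S}
  zero_mem' := by
    change upperUnipotent 0 ∈ S
    rw [upperUnipotent_zero]
    exact one_mem S
  add_mem' := fun {s t} hs ht => by
    change upperUnipotent (s + t) ∈ S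
    rw [upperUnipotent_add]
    exact mul_mem hs ht
  neg_mem' := fun {t} ht => by
    change upperUnipotent (-t) ∈ S
    have : upperUnipotent (-t) = (upperUnipotent t)⁻¹ := by
      rw [eq_inv_iff_mul_eq_one, ← upperUnipotent_add, neg_add_cancel, upperUnipotent_zero]
    rw [this]
    exact inv_mem ht

lemma diag_pow {a : SL(2, ℝ)} (h1 : a 0 1 = 0) (h2 : a 1 0 = 0) (k : ℕ) :
    (a ^ k) 0 0 = a 0 0 ^ k ∧ (a ^ k) 0 1 = 0 ∧ (a ^ k) 1 0 = 0 := by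
  induction k with
  | zero => simp
  | succ k ih =>
    rw [pow_succ]
    simp only [SL_mul_apply, ih, h1, h2]
    exact ⟨by ring, by ring, by ring⟩

/-- Conjugation by a diagonal matrix; the lower left entry is left multiplied out to avoid a
division. -/
lemma diag_conj_apply {d : SL(2, ℝ)} (h1 : d 0 1 = 0) (h2 : d 1 0 = 0) (g : SL(2, ℝ)) :
    (d * g * d⁻¹) 0 0 = g 0 0 ∧ (d * g * d⁻¹) 0 1 = d 0 0 ^ 2 * g 0 1 ∧
      d 0 0 ^ 2 * (d * g * d⁻¹) 1 0 = g 1 0 ∧ (d * g * d⁻¹) 1 1 = g 1 1 := by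
  obtain ⟨i1, i2, i3, i4⟩ := SL_inv_apply d
  have hd := SL_det d
  rw [h1] at hd
  simp only [SL_mul_apply, i1, i2, i3, i4, h1, h2]
  refine ⟨?_, ?_, ?_, ?_⟩
  · linear_combination g 0 0 * hd
  · ring
  · linear_combination g 1 0 * (d 0 0 * d 1 1 + 1) * hd
  · linear_combination g 1 1 * hd

/-- A closed group which contains a diagonal matrix expanding the upper right entry, and matrices
arbitrarily close to `1` whose upper right entry is not zero, contains all upper unipotent matrices: conjugation by powers of
the diagonal matrix expands the upper right entry to unit size while it contracts the lower left
one, which produces unipotent matrices in the limit. -/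
lemma upperUnipotent_mem_of_frequently {S : Subgroup SL(2, ℝ)} (hS : IsClosed (S : Set SL(2, ℝ)))
    {a : SL(2, ℝ)} (ha : a ∈ S) (ha1 : a 0 1 = 0) (ha2 : a 1 0 = 0) (ha3 : 1 < a 0 0 ^ 2)
    (hfr : ∃ᶠ g in 𝓝 (1 : SL(2, ℝ)), g ∈ S ∧ g 0 1 ≠ 0) (t : ℝ) : upperUnipotent t ∈ S := by
  set l : ℝ := a 0 0 ^ 2 with hl
  have hl0 : 0 < l := one_pos.trans ha3
  have hsmall : ∀ᶠ g in 𝓝 (1 : SL(2, ℝ)), |g 0 1| < 1 := by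
    have : Tendsto (fun g : SL(2, ℝ) => |g 0 1|) (𝓝 1) (𝓝 |(1 : SL(2, ℝ)) 0 1|) :=
      (continuous_SL_apply 0 1).abs.tendsto 1
    exact this.eventually_lt_const (by simp)
  have := firstCountableTopology_SL
  obtain ⟨g, hg, hgS⟩ := exists_seq_forall_of_frequently (hfr.and_eventually hsmall)
  have hpow : ∀ k : ℕ, (a ^ k) 0 0 ^ 2 = l ^ k := fun k => by
    rw [(diag_pow ha1 ha2 k).1, hl]
    ring
  -- conjugating by powers of `a` brings the upper right entry to unit size
  have hex : ∀ n, ∃ h ∈ S, h 0 0 = g n 0 0 ∧ h 1 1 = g n 1 1 ∧ |h 1 0| ≤ |g n 1 0| ∧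
      l⁻¹ ≤ |h 0 1| ∧ |h 0 1| ≤ 1 := by
    intro n
    obtain ⟨⟨h1, h2⟩, h3⟩ := hgS n
    have hb : 0 < |g n 0 1| := abs_pos.2 h2
    obtain ⟨k, hk1, hk2⟩ := exists_nat_pow_near ((one_le_inv₀ hb).2 h3.le) ha3
    obtain ⟨-, d1, d2⟩ := diag_pow ha1 ha2 k
    obtain ⟨c1, c2, c3, c4⟩ := diag_conj_apply d1 d2 (g n)
    rw [hpow] at c2 c3
    have hlk : 0 < l ^ k := pow_pos hl0 k
    refine ⟨a ^ k * g n * (a ^ k)⁻¹, mul_mem (mul_mem (pow_mem ha k) h1) (inv_mem (pow_mem ha k)),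
      c1, c4, ?_, ?_, ?_⟩
    · rw [← c3, abs_mul, abs_of_pos hlk]
      exact le_mul_of_one_le_left (abs_nonneg _) (one_le_pow₀ ha3.le)
    · rw [c2, abs_mul, abs_of_pos hlk, inv_le_iff_one_le_mul₀ hl0]
      rw [inv_lt_iff_one_lt_mul₀ hb, pow_succ] at hk2
      nlinarith
    · rw [c2, abs_mul, abs_of_pos hlk]
      rwa [le_inv_comm₀ hlk hb, ← one_div, le_div_iff₀ hlk, mul_comm] at hk1
  choose h hhS h00 h11 h10 h01 h01' using hex
  obtain ⟨b, hb, ψ, hψ, hlim⟩ := (isCompact_Icc (a := (-1 : ℝ)) (b := 1)).tendsto_subseq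
    (x := fun n => h n 0 1) fun n => abs_le.1 (h01' n)
  have hb0 : 0 < |b| := (inv_pos.2 hl0).trans_le
    (ge_of_tendsto' hlim.abs fun n => h01 (ψ n))
  have hgent := tendsto_SL_iff.1 (hg.comp hψ.tendsto_atTop)
  obtain ⟨u1, u2, u3, u4⟩ := upperUnipotent_apply b
  have hbS : b ∈ unipotentParams S := by
    change upperUnipotent b ∈ S
    refine hS.mem_of_tendsto (b := atTop) (f := fun n => h (ψ n)) (tendsto_SL_iff.2 ?_)
      (Eventually.of_forall fun n => hhS _)
    intro i j
    fin_cases i <;> fin_cases j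
    · simpa [u1, h00] using hgent 0 0
    · simpa [u2, Function.comp_def] using hlim
    · have h1 : Tendsto (fun n => |g (ψ n) 1 0|) atTop (𝓝 0) := by
        simpa using (hgent 1 0).abs
      have := squeeze_zero_norm (f := fun n => h (ψ n) 1 0) (fun n => h10 (ψ n)) h1
      simpa [u3] using this
    · simpa [u4, h11] using hgent 1 1
  have hbS' : |b| ∈ unipotentParams S := by
    rcases abs_choice b with h | h <;> rw [h]
    · exact hbS
    · exact neg_mem hbS
  -- conjugating back by powers of `a` gives arbitrarily small parameters
  have hscale : ∀ k : ℕ, (l ^ k)⁻¹ * |b| ∈ unipotentParams S := by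
    intro k
    obtain ⟨-, d1, d2⟩ := diag_pow ha1 ha2 k
    have hlk : 0 < l ^ k := pow_pos hl0 k
    have key : upperUnipotent |b| =
        a ^ k * upperUnipotent ((l ^ k)⁻¹ * |b|) * (a ^ k)⁻¹ := by
      obtain ⟨c1, c2, c3, c4⟩ := diag_conj_apply d1 d2 (upperUnipotent ((l ^ k)⁻¹ * |b|))
      obtain ⟨v1, v2, v3, v4⟩ := upperUnipotent_apply |b|
      obtain ⟨w1, w2, w3, w4⟩ := upperUnipotent_apply ((l ^ k)⁻¹ * |b|)
      rw [hpow] at c2 c3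
      apply SL_ext
      · rw [c1, v1, w1]
      · rw [c2, v2, w2, mul_inv_cancel_left₀ hlk.ne']
      · rw [w3] at c3
        rw [v3, (mul_eq_zero.1 c3).resolve_left hlk.ne']
      · rw [c4, v4, w4]
    have h2 : upperUnipotent ((l ^ k)⁻¹ * |b|) = (a ^ k)⁻¹ * upperUnipotent |b| * a ^ k := by
      rw [key]; group
    change upperUnipotent _ ∈ S
    rw [h2]
    exact mul_mem (mul_mem (inv_mem (pow_mem ha k)) hbS') (pow_mem ha k)
  have hdense : Dense (unipotentParams S : Set ℝ) := by
    refine AddSubgroup.dense_of_not_isolated_zero _ fun ε hε => ?_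
    obtain ⟨k, hk⟩ := exists_pow_lt_of_lt_one (div_pos hε hb0) (inv_lt_one_of_one_lt₀ ha3)
    refine ⟨_, hscale k, by positivity, ?_⟩
    rwa [inv_pow, lt_div_iff₀ hb0] at hk
  have hclosed : IsClosed (unipotentParams S : Set ℝ) := hS.preimage continuous_upperUnipotent
  have := hdense.closure_eq
  rw [hclosed.closure_eq] at this
  have ht : t ∈ (unipotentParams S : Set ℝ) := by rw [this]; exact mem_univ t
  exact ht

/-- A non-discrete group of matrices containing an element which does not preserve the pair `{0, ∞}`
of endpoints of the axis contains matrices arbitrarily close to `1` which are not diagonal. -/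
lemma frequently_off_diag_ne_zero {S : Subgroup SL(2, ℝ)} (hS : ¬ DiscreteTopology S)
    {γ : SL(2, ℝ)} (hγ : γ ∈ S) (hγ' : γ 0 0 * γ 0 1 ≠ 0 ∨ γ 1 0 * γ 1 1 ≠ 0) :
    (∃ᶠ g in 𝓝 (1 : SL(2, ℝ)), g ∈ S ∧ g 0 1 ≠ 0) ∨
      ∃ᶠ g in 𝓝 (1 : SL(2, ℝ)), g ∈ S ∧ g 1 0 ≠ 0 := by
  have hfr : ∃ᶠ g in 𝓝 (1 : SL(2, ℝ)), g ∈ S ∧ g ≠ 1 := by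
    intro hev
    apply hS
    refine discreteTopology_of_isOpen_singleton_one ?_
    rw [isOpen_singleton_iff_nhds_eq_pure]
    refine le_antisymm (le_pure_iff.2 ?_) (pure_le_nhds _)
    filter_upwards [(continuous_subtype_val (p := (· ∈ S))).tendsto 1 |>.eventually hev] with g hg
    by_contra hne
    exact hg ⟨g.2, fun h => hne (Subtype.ext h)⟩
  -- otherwise elements near `1` are diagonal, and so are their conjugates by `γ`
  by_contra! hcon
  obtain ⟨hb, hc⟩ := hcon
  have hconj : Tendsto (fun g => γ * g * γ⁻¹) (𝓝 (1 : SL(2, ℝ))) (𝓝 1) := by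
    have : Continuous fun g : SL(2, ℝ) => γ * g * γ⁻¹ := by fun_prop
    exact this.tendsto' 1 1 (by simp)
  have hpos : ∀ᶠ g in 𝓝 (1 : SL(2, ℝ)), 0 < g 0 0 :=
    ((continuous_SL_apply 0 0).tendsto 1).eventually_const_lt (by simp)
  obtain ⟨g, ⟨hgS, hg1⟩, hb1, hc1, hb2, hc2, hp⟩ := (hfr.and_eventually (hb.and (hc.and
    ((hconj.eventually hb).and ((hconj.eventually hc).and hpos))))).exists
  have hmem : γ * g * γ⁻¹ ∈ S := mul_mem (mul_mem hγ hgS) (inv_mem hγ)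
  have e1 := hb1 hgS
  have e2 := hc1 hgS
  have e3 := hb2 hmem
  have e4 := hc2 hmem
  obtain ⟨i1, i2, i3, i4⟩ := SL_inv_apply γ
  simp only [SL_mul_apply, i1, i2, i3, i4, e1, e2] at e3 e4
  have hdet := SL_det g
  rw [e1, e2] at hdet
  have hne : g 1 1 - g 0 0 ≠ 0 := by
    intro h
    have h1 : g 1 1 = g 0 0 := by linarith
    have h2 : g 0 0 = 1 := by
      rw [h1] at hdet
      nlinarith
    exact hg1 (SL_ext (by simpa using h2) (by simpa using e1) (by simpa using e2)
      (by simpa [h1] using h2))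
  rcases hγ' with h | h
  · exact mul_ne_zero h hne (by linear_combination e3)
  · exact mul_ne_zero h hne (by linear_combination -e4)

/-! ### The invariance group of an eigenfunction -/

/-- The group of all orientation preserving isometries which leave `φ` invariant. -/
def invarianceGroup (φ : ℍ → ℝ) : Subgroup SL(2, ℝ) where
  carrier := {g | ∀ z, φ (g • z) = φ z}
  one_mem' := fun z => by rw [one_smul]
  mul_mem' := fun {g h} hg hh z => by rw [mul_smul, hg, hh]
  inv_mem' := fun {g} hg z => by
    have := hg (g⁻¹ • z)
    rwa [smul_inv_smul, eq_comm] at this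

lemma mem_invarianceGroup {φ : ℍ → ℝ} {g : SL(2, ℝ)} :
    g ∈ invarianceGroup φ ↔ ∀ z, φ (g • z) = φ z := Iff.rfl

lemma isClosed_invarianceGroup {φ : ℍ → ℝ} (hφ : Continuous φ) :
    IsClosed (invarianceGroup φ : Set SL(2, ℝ)) := by
  have : (invarianceGroup φ : Set SL(2, ℝ)) = ⋂ z, {g | φ (g • z) = φ z} := by
    ext g
    simp only [SetLike.mem_coe, mem_invarianceGroup, mem_iInter]
    rfl
  rw [this]
  exact isClosed_iInter fun z => isClosed_eq (by fun_prop) continuous_const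

/-- The translates of the axis by the upper unipotent matrices cover the plane. -/
lemma eq_zero_of_frequently {φ : ℍ → ℝ} (hφ : Continuous φ) (h0 : ∀ t, φ (axis t) = 0)
    {a : SL(2, ℝ)} (ha : a ∈ invarianceGroup φ) (ha1 : a 0 1 = 0) (ha2 : a 1 0 = 0)
    (ha3 : 1 < a 0 0 ^ 2)
    (hfr : ∃ᶠ g in 𝓝 (1 : SL(2, ℝ)), g ∈ invarianceGroup φ ∧ g 0 1 ≠ 0) (z : ℍ) : φ z = 0 := by
  have h1 : upperUnipotent z.re • axis (Real.log z.im) = z := by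
    have h2 := smul_mul_denom (upperUnipotent z.re) (axis (Real.log z.im))
    obtain ⟨u1, u2, u3, u4⟩ := upperUnipotent_apply z.re
    rw [u1, u2, u3, u4, coe_axis, Real.exp_log z.im_pos] at h2
    ext
    have h3 : (z : ℂ) = z.im * Complex.I + z.re := by
      apply Complex.ext <;> simp
    rw [h3]
    simpa using h2
  have h2 := upperUnipotent_mem_of_frequently (isClosed_invarianceGroup hφ) ha ha1 ha2 ha3 hfr z.re
  have := h2 (axis (Real.log z.im))
  rw [h1, h0] at this
  exact this

lemma discreteTopology_invarianceGroup {φ : ℍ → ℝ} (hφ : Continuous φ)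
    (h0 : ∀ t, φ (axis t) = 0) {z₀ : ℍ} (hz₀ : φ z₀ ≠ 0) {a : SL(2, ℝ)}
    (ha : a ∈ invarianceGroup φ) (ha1 : a 0 1 = 0) (ha2 : a 1 0 = 0) (ha3 : 1 < a 0 0 ^ 2)
    {γ : SL(2, ℝ)} (hγ : γ ∈ invarianceGroup φ)
    (hγ' : γ 0 0 * γ 0 1 ≠ 0 ∨ γ 1 0 * γ 1 1 ≠ 0) : DiscreteTopology (invarianceGroup φ) := by
  by_contra hS
  rcases frequently_off_diag_ne_zero hS hγ hγ' with hfr | hfr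
  · exact hz₀ (eq_zero_of_frequently hφ h0 ha ha1 ha2 ha3 hfr z₀)
  · -- the rotation by `π` about `i` exchanges the two off-diagonal entries
    let j : SL(2, ℝ) := ⟨!![0, -1; 1, 0], by simp⟩
    have j1 : j 0 0 = 0 := rfl
    have j2 : j 0 1 = -1 := rfl
    have j3 : j 1 0 = 1 := rfl
    have j4 : j 1 1 = 0 := rfl
    obtain ⟨i1, i2, i3, i4⟩ := SL_inv_apply j
    have hmem : ∀ g ∈ invarianceGroup φ, j * g * j⁻¹ ∈ invarianceGroup fun z => φ (j⁻¹ • z) := by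
      intro g hg z
      change φ (j⁻¹ • ((j * g * j⁻¹) • z)) = φ (j⁻¹ • z)
      rw [← hg (j⁻¹ • z), ← mul_smul, ← mul_smul]
      congr 2
      group
    have hent : ∀ g : SL(2, ℝ), (j * g * j⁻¹) 0 0 = g 1 1 ∧ (j * g * j⁻¹) 0 1 = -g 1 0 ∧
        (j * g * j⁻¹) 1 0 = -g 0 1 := fun g => by
      simp only [SL_mul_apply, i1, i2, i3, i4, j1, j2, j3, j4]
      exact ⟨by ring, by ring, by ring⟩
    obtain ⟨a1, a2, a3, a4⟩ := SL_inv_apply a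
    obtain ⟨b1, b2, b3⟩ := hent a⁻¹
    have haxis : ∀ t, j⁻¹ • axis t = axis (-t) := fun t => by
      have h2 := smul_mul_denom j⁻¹ (axis t)
      rw [i1, i2, i3, i4, j1, j2, j3, j4, coe_axis] at h2
      ext
      rw [coe_axis, Real.exp_neg]
      have ht : (Real.exp t : ℂ) ≠ 0 := by exact_mod_cast (Real.exp_pos t).ne'
      apply mul_right_cancel₀ (mul_ne_zero ht Complex.I_ne_zero)
      simp only [Complex.ofReal_neg, Complex.ofReal_one, Complex.ofReal_zero, neg_mul, one_mul,
        zero_mul, neg_neg, add_zero, zero_add, mul_neg] at h2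
      rw [Complex.ofReal_inv, show ((Real.exp t : ℂ))⁻¹ * Complex.I * (Real.exp t * Complex.I) =
        (Real.exp t : ℂ)⁻¹ * Real.exp t * (Complex.I * Complex.I) by ring, inv_mul_cancel₀ ht,
        Complex.I_mul_I]
      linear_combination -h2
    have hconj : Tendsto (fun g => j * g * j⁻¹) (𝓝 (1 : SL(2, ℝ))) (𝓝 1) := by
      have : Continuous fun g : SL(2, ℝ) => j * g * j⁻¹ := by fun_prop
      exact this.tendsto' 1 1 (by simp)
    have hfr' : ∃ᶠ g in 𝓝 (1 : SL(2, ℝ)),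
        g ∈ (invarianceGroup fun z => φ (j⁻¹ • z)) ∧ g 0 1 ≠ 0 := by
      refine hconj.frequently (hfr.mono fun g hg => ⟨hmem g hg.1, ?_⟩)
      rw [(hent g).2.1]
      exact neg_ne_zero.2 hg.2
    have := eq_zero_of_frequently (φ := fun z => φ (j⁻¹ • z)) (by fun_prop)
      (fun t => by rw [haxis, h0]) (hmem _ (inv_mem ha)) (by rw [b2, a3, ha2]; simp)
      (by rw [b3, a2, ha1]; simp) (by rw [b1, a4]; exact ha3) hfr' (j • z₀)
    rw [inv_smul_smul] at this
    exact hz₀ this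

/-- A cocompact group does not preserve the pair `{0, ∞}` of endpoints of the axis, as otherwise
`|re z| / im z` would be invariant and therefore bounded. -/
lemma exists_mem_mul_ne_zero (Γ : Subgroup SL(2, ℝ))
    [CompactSpace (MulAction.orbitRel.Quotient Γ ℍ)] :
    ∃ γ ∈ Γ, γ 0 0 * γ 0 1 ≠ 0 ∨ γ 1 0 * γ 1 1 ≠ 0 := by
  by_contra! hcon
  have hinv : ∀ g ∈ Γ, ∀ z : ℍ, |(g • z).re| * z.im = (g • z).im * |z.re| := by
    intro g hg z
    obtain ⟨h1, h2⟩ := hcon g hg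
    have hdet := SL_det g
    have h3 := smul_mul_denom g z
    have him := z.im_pos
    have him' := (g • z).im_pos
    have key : |(g • z).re * z.im| = |(g • z).im * z.re| := by
      rcases mul_eq_zero.1 h1 with h0 | h0
      · have h5 : g 1 0 ≠ 0 := fun h => by rw [h0, h] at hdet; norm_num at hdet
        have h6 : g 1 1 = 0 := (mul_eq_zero.1 h2).resolve_left h5
        rw [h0, h6] at h3
        have h7 := congrArg Complex.im h3
        simp at h7
        have h8 : g 1 0 * ((g • z).re * z.im + (g • z).im * z.re) = 0 := by linarith
        have h9 := (mul_eq_zero.1 h8).resolve_left h5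
        rw [eq_neg_of_add_eq_zero_left h9, abs_neg]
      · have h5 : g 1 1 ≠ 0 := fun h => by rw [h0, h] at hdet; norm_num at hdet
        have h6 : g 1 0 = 0 := (mul_eq_zero.1 h2).resolve_right h5
        rw [h0, h6] at h3
        have h7 := congrArg Complex.im h3
        have h7' := congrArg Complex.re h3
        simp at h7 h7'
        have h8 : g 1 1 * ((g • z).re * z.im - (g • z).im * z.re) = 0 := by
          linear_combination z.im * h7' - z.re * h7
        have h9 := (mul_eq_zero.1 h8).resolve_left h5
        rw [sub_eq_zero.1 h9]
    rwa [abs_mul, abs_mul, abs_of_pos him, abs_of_pos him'] at key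
  obtain ⟨R, hR⟩ := exists_dist_smul_le Γ
  have hc : ContinuousOn (fun z : ℍ => |z.re| / z.im) (Metric.closedBall UpperHalfPlane.I R) :=
    (UpperHalfPlane.continuous_re.abs.div UpperHalfPlane.continuous_im
      fun z => z.im_ne_zero).continuousOn
  obtain ⟨M, hM⟩ := (isCompact_closedBall (UpperHalfPlane.I : ℍ) R).exists_bound_of_continuousOn hc
  obtain ⟨g, hg, hgR⟩ := hR (horoPoint (|M| + 1))
  have h1 := hM _ (Metric.mem_closedBall.2 hgR)
  have h2 := hinv g hg (horoPoint (|M| + 1))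
  have hre : (horoPoint (|M| + 1)).re = |M| + 1 := rfl
  have him : (horoPoint (|M| + 1)).im = 1 := rfl
  rw [hre, him, mul_one] at h2
  have him' := (g • horoPoint (|M| + 1)).im_pos
  rw [h2, mul_div_cancel_left₀ _ him'.ne', Real.norm_eq_abs, abs_abs,
    abs_of_pos (by positivity)] at h1
  linarith [le_abs_self M]

/-- A cocompact group has finite index in every group between it and a discrete group. -/
lemma finiteIndex_of_le_transf {Γ S : Subgroup SL(2, ℝ)} [DiscreteTopology S]
    [CompactSpace (MulAction.orbitRel.Quotient Γ ℍ)] {H : Subgroup (Equiv.Perm ℍ)}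
    (hΓH : transf Γ ≤ H) (hHS : H ≤ transf S) : ((transf Γ).subgroupOf H).FiniteIndex := by
  obtain ⟨R, hR⟩ := exists_dist_smul_le Γ
  have hfin : {h : H | dist (h⁻¹.1 UpperHalfPlane.I) UpperHalfPlane.I ≤ R}.Finite := by
    refine Set.Finite.of_finite_image (f := fun h : H => (h⁻¹).1)
      ((finite_setOf_dist_transf_le S R).subset ?_) ?_
    · rintro _ ⟨h, hh, rfl⟩
      exact ⟨hHS (h⁻¹).2, hh⟩
    · exact (Subtype.val_injective.comp inv_injective).injOn
  have : Finite (H ⧸ (transf Γ).subgroupOf H) := by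
    rw [← finite_univ_iff]
    refine (hfin.image (QuotientGroup.mk : H → H ⧸ (transf Γ).subgroupOf H)).subset ?_
    rintro ⟨p⟩ -
    obtain ⟨g, hg, hgR⟩ := hR ((p⁻¹).1 UpperHalfPlane.I)
    have hgΓ : MulAction.toPermHom SL(2, ℝ) ℍ g ∈ transf Γ := ⟨g, hg, rfl⟩
    refine ⟨p * ⟨_, hΓH hgΓ⟩⁻¹, ?_, ?_⟩
    · change dist (((p * ⟨_, hΓH hgΓ⟩⁻¹)⁻¹ : H).1 UpperHalfPlane.I) UpperHalfPlane.I ≤ R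
      rw [mul_inv_rev, inv_inv]
      exact hgR
    · refine QuotientGroup.eq.2 ?_
      rw [Subgroup.mem_subgroupOf]
      simpa using hgΓ
  exact Subgroup.finiteIndex_of_finite_quotient

/-- The group generated by `Γ` and its conjugate lies between `Γ` and the discrete invariance group
of the eigenfunction. -/
theorem finiteIndex_of_exists_eigenfunction (Γ : Subgroup SL(2, ℝ))
    [CompactSpace (MulAction.orbitRel.Quotient Γ ℍ)] (hγ : AxisIsClosed Γ) {φ : ℍ → ℝ} {μ : ℝ}
    (hφ : IsLaplaceEigenfunction Γ μ φ) (hne : ¬ ∃ c : ℝ, ∀ z : ℍ, φ z = c)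
    (h0 : ∀ t, φ (axis t) = 0) : ((transf Γ).subgroupOf (symmGroup Γ)).FiniteIndex := by
  have hodd := hφ.comp_rho_eq_neg hγ h0
  have hcont : Continuous φ := by
    have := hφ.contDiffOn.continuousOn.comp_continuous UpperHalfPlane.continuous_coe
      fun z => z.im_pos
    refine this.congr fun z => ?_
    simp
  have hle : Γ ≤ invarianceGroup φ := fun g hg => hφ.invariant g hg
  obtain ⟨a, ha, L, hL, haL⟩ := hγ
  obtain ⟨ha1, ha2, ha3⟩ := entries_of_smul_axis haL
  have ha4 : 1 < a 0 0 ^ 2 := by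
    have hdet := SL_det a
    rw [ha1, zero_mul, sub_zero] at hdet
    have h1 : a 0 0 ^ 2 = Real.exp L := by
      rw [sq]
      nth_rw 2 [ha3]
      linear_combination Real.exp L * hdet
    rw [h1]
    exact Real.one_lt_exp_iff.2 hL
  obtain ⟨γ, hγΓ, hγ'⟩ := exists_mem_mul_ne_zero Γ
  obtain ⟨z₀, hz₀⟩ : ∃ z, φ z ≠ 0 := by
    by_contra! h
    exact hne ⟨0, h⟩
  have := discreteTopology_invarianceGroup hcont h0 hz₀ (hle ha) ha1 ha2 ha4 (hle hγΓ) hγ'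
  refine finiteIndex_of_le_transf (S := invarianceGroup φ) le_sup_left
    (sup_le (Subgroup.map_mono hle) fun p hp => ?_)
  obtain ⟨g, hg, hgp⟩ := mem_transf.1 (mem_rhoConj.1 hp)
  obtain ⟨g', hg'⟩ := exists_SL_smul_eq_rho_conj g
  refine mem_transf.2 ⟨g', fun z => ?_, fun z => ?_⟩
  · rw [hg', hodd, hφ.invariant g hg, hodd, neg_neg]
  · rw [hg', ← hgp]
    simp

end

end HypSurf

theorem mainTheorem3 (Γ : Subgroup SL(2, ℝ)) [DiscreteTopology Γ]
    [CompactSpace (MulAction.orbitRel.Quotient Γ ℍ)] (hγ : HypSurf.AxisIsClosed Γ) :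
    (∃ (φ : ℍ → ℝ) (μ : ℝ), HypSurf.IsLaplaceEigenfunction Γ μ φ ∧
        (¬ ∃ c : ℝ, ∀ z : ℍ, φ z = c) ∧ ∀ t : ℝ, φ (HypSurf.axis t) = 0) ↔
      ((HypSurf.transf Γ).subgroupOf (HypSurf.symmGroup Γ)).FiniteIndex := by
  constructor
  · rintro ⟨φ, μ, hφ, hne, h0⟩
    exact HypSurf.finiteIndex_of_exists_eigenfunction Γ hγ hφ hne h0
  · exact HypSurf.exists_eigenfunction_of_finiteIndex Γ
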